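/- Let $Q_d=\{0,1\}^d$. For integers $0\le k\le d$, a $k$-dimensional subcube of $Q_d$ is a set obtained by fixing $d-k$ of the coordinates and letting the other $k$ vary freely. For a finite set $V$, let $G_{V,d,k}$ be the random graph on $V$ obtained by choosing, independently for each $v\in V$, a uniformly random $k$-dimensional subcube $f(v)$ of $Q_d$, and joining distinct $u,v\in V$ by an edge if and only if $f(u)\cap f(v)\neq\emptyset$. Write $\omega(G)$ for the clique number of $G$. For an integer $s\ge 1$ and $p\in(0,1)$ put $$t_{K_s}(p)=-\frac1s\log\Bigl(2\bigl(\tfrac{1+p}{2}\bigr)^s-p^s\Bigr),\qquad \alpha_s(p)=\frac{p\,\bigl(2(\frac{1+p}{2})^{s-1}-p^{s-1}\bigr)}{2(\frac{1+p}{2})^{s}-p^{s}};$$ the function $\alpha_s$ is a bijection from $(0,1)$ to itself. For $\alpha\in(0,1)$ put, with $p=\alpha_s^{-1}(\alpha)$, $$T_{K_s}=T_{K_s}(\alpha)=t_{K_s}(p)+\alpha\log\frac{p}{\alpha}+(1-\alpha)\log\frac{1-p}{1-\alpha},\qquad T_{\mathrm{cover}}=T_{\mathrm{cover}}(\alpha)=(1-\alpha)\log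 2 .$$ **Corollary (clique number transition, uniform model).** Let $\alpha\in(0,1)$ be fixed, let $k=k(d)=\lfloor\alpha d\rfloor$, let $V=V(d)$ be a sequence of non-empty finite vertex sets, and let $x=x(d)=\frac1d\log|V(d)|$. All asymptotics are as $d\to\infty$, and "whp" means with probability tending to $1$ as $d\to\infty$. The following hold: - if there are an integer $s\ge1$ and a constant $\varepsilon>0$ such that $T_{K_s}+\varepsilon<x(d)<T_{K_{s+1}}-\varepsilon$ for all sufficiently large $d$, then whp $\omega(G_{V,d,k})=s$; - if there is an integer $s\ge1$ such that $x(d)=T_{K_s}+o(1)$, then whp $\omega(G_{V,d,k})\in\{s-1,s\}$; - if there is $\gamma>1$ such that $x(d)=T_{\mathrm{cover}}+\gamma\frac{\log d}{d}+o\bigl(\frac{\log d}{d}\bigr)$, then $\omega(G_{V,d,k})=d^{\gamma+o(1)}$ whp, that is, there is a deterministic sequence $r(d)\to0$ such that whp $d^{\gamma-r(d)}\le\omega(G_{V,d,k})\le d^{\gamma+r(d)}$; - if there is $c>0$ such that $x(d)=T_{\mathrm{cover}}+c+o(1)$, then $\omega(G_{V,d,k})=e^{cd+o(d)}$ whp,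 that is, there is a deterministic sequence $r(d)\to0$ such that whp $e^{(c-r(d))d}\le\omega(G_{V,d,k})\le e^{(c+r(d))d}$. -/

import Mathlib

open Filter Topology MeasureTheory Asymptotics

/-- The hypercube `Q_d = {0,1}^d`. -/
abbrev Hypercube (d : ℕ) : Type := Fin d → Bool

/-- Subcubes of `Q_d` as vectors in `{0,1,⋆}^d`; `none` is the free symbol `⋆`, and `some b`
means that the coordinate is fixed to be `b`. -/
def Subcube (d : ℕ) : Type := Fin d → Option Bool

namespace Subcube

instance instFintype (d : ℕ) : Fintype (Subcube d) :=
  inferInstanceAs (Fintype (Fin d → Option Bool))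

/-- Every set of subcubes is an event. -/
instance instMeasurableSpace (d : ℕ) : MeasurableSpace (Subcube d) := ⊤

instance instDiscreteMeasurableSpace (d : ℕ) : DiscreteMeasurableSpace (Subcube d) :=
  ⟨fun _ => trivial⟩

/-- The set of points of the hypercube that lie in the subcube `c`. -/
def points {d : ℕ} (c : Subcube d) : Set (Hypercube d) :=
  {x | ∀ i : Fin d, ∀ b : Bool, c i = some b → x i = b}

/-- The dimension of a subcube is the number of its free coordinates. -/
def dim {d : ℕ} (c : Subcube d) : ℕ :=
  (Finset.univ.filter fun i : Fin d => (c i).isNone).card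

theorem exists_dim_eq {d k : ℕ} (hk : k ≤ d) : ∃ c : Subcube d, c.dim = k := by
  obtain ⟨t, -, ht⟩ := Finset.exists_subset_card_eq
    (s := (Finset.univ : Finset (Fin d))) (n := k) (by simpa using hk)
  classical
  refine ⟨fun i => if i ∈ t then none else some false, ?_⟩
  rw [← ht]
  refine congrArg Finset.card ?_
  ext i
  by_cases h : i ∈ t <;> simp [h]

end Subcube

/-- The intersection graph of the feature system `(V, Ω, f)`: distinct vertices are adjacent if and
only if their feature sets meet. -/
def intersectionGraph {V Ω : Type*} (f : V → Set Ω) : SimpleGraph V where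
  Adj u v := u ≠ v ∧ (f u ∩ f v).Nonempty
  symm := ⟨fun u v h => ⟨h.1.symm, by rw [Set.inter_comm]; exact h.2⟩⟩
  loopless := ⟨fun _ h => h.1 rfl⟩

/-- The subcube intersection graph on `V` with feature subcubes `f v`, `v ∈ V`. -/
def subcubeGraph {V : Type*} {d : ℕ} (f : V → Subcube d) : SimpleGraph V :=
  intersectionGraph fun v => (f v).points

/-- The law of the feature subcubes `(f v)_{v ∈ V}` in the uniform model `G_{V,d,k}`: they are
independent, and each of them is uniform on the set of `k`-dimensional subcubes of `Q_d`. -/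
noncomputable def uniformModel (V : Type*) [Fintype V] (d k : ℕ) : Measure (V → Subcube d) :=
  Measure.pi fun _ : V => ProbabilityTheory.uniformOn {c : Subcube d | c.dim = k}

theorem isProbabilityMeasure_uniformModel (V : Type*) [Fintype V] {d k : ℕ} (hk : k ≤ d) :
    IsProbabilityMeasure (uniformModel V d k) := by
  have : IsProbabilityMeasure (ProbabilityTheory.uniformOn {c : Subcube d | c.dim = k}) :=
    ProbabilityTheory.isProbabilityMeasure_uniformOn (Set.toFinite _) (Subcube.exists_dim_eq hk)
  unfold uniformModel
  infer_instance

/-- For `G_d = G_{V(d),d,k(d)}`, the statement that `ω(G_d) ∈ A d` with high probability, that is,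
with probability tending to `1` as `d → ∞`, where `ω` is the clique number. -/
def WhpCliqueNum (V : ℕ → Type*) [∀ d, Fintype (V d)] (k : ℕ → ℕ) (A : ℕ → Set ℕ) : Prop :=
  Tendsto (fun d : ℕ => uniformModel (V d) d (k d)
    {f : V d → Subcube d | (subcubeGraph f).cliqueNum ∈ A d}) atTop (𝓝 1)

/-- `t_{K_s}(p) = -(1/s) log (2((1+p)/2)^s - p^s)`, for `s ≥ 1`. -/
noncomputable def tClique (s : ℕ) (p : ℝ) : ℝ :=
  -(1 / (s : ℝ)) * Real.log (2 * ((1 + p) / 2) ^ s - p ^ s)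

/-- The function `α_s`, for `s ≥ 1`. -/
noncomputable def alphaFun (s : ℕ) (p : ℝ) : ℝ :=
  p * (2 * ((1 + p) / 2) ^ (s - 1) - p ^ (s - 1)) / (2 * ((1 + p) / 2) ^ s - p ^ s)

/-- The inverse of the bijection `α_s : (0,1) → (0,1)`; see `bijOn_alphaFun`. -/
noncomputable def alphaInv (s : ℕ) (a : ℝ) : ℝ :=
  Function.invFunOn (alphaFun s) (Set.Ioo 0 1) a

/-- `T_{K_s}(α) = t_{K_s}(p) + α log (p/α) + (1-α) log ((1-p)/(1-α))` with `p = α_s⁻¹(α)`. -/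
noncomputable def TClique (s : ℕ) (a : ℝ) : ℝ :=
  tClique s (alphaInv s a) + a * Real.log (alphaInv s a / a)
    + (1 - a) * Real.log ((1 - alphaInv s a) / (1 - a))

/-- `T_cover(α) = (1-α) log 2`. -/
noncomputable def TCover (a : ℝ) : ℝ := (1 - a) * Real.log 2

theorem alphaFun_denom_pos (m : ℕ) {p : ℝ} (h0 : 0 ≤ p) (h1 : p ≤ 1) :
    0 < 2 * ((1 + p) / 2) ^ m - p ^ m := by
  have h2 : p ^ m ≤ ((1 + p) / 2) ^ m := pow_le_pow_left₀ h0 (by linarith) m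
  have h3 : 0 < ((1 + p) / 2) ^ m := by positivity
  linarith

theorem alphaFun_eq {s : ℕ} (hs : 1 ≤ s) {p : ℝ} (h0 : 0 ≤ p) (h1 : p ≤ 1) :
    alphaFun s p = 1 - 2 * (1 - 2 * p / (1 + p)) / (2 - (2 * p / (1 + p)) ^ s) := by
  obtain ⟨m, rfl⟩ : ∃ m, s = m + 1 := ⟨s - 1, by omega⟩
  have hd := alphaFun_denom_pos (m + 1) h0 h1
  have hu : 0 < (1 + p) / 2 := by positivity
  have hy : 2 * p / (1 + p) = p / ((1 + p) / 2) := by field_simp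
  have hd2 : 2 - (p / ((1 + p) / 2)) ^ (m + 1)
      = (2 * ((1 + p) / 2) ^ (m + 1) - p ^ (m + 1)) / ((1 + p) / 2) ^ (m + 1) := by
    rw [div_pow]; field_simp
  unfold alphaFun
  rw [hy, hd2, Nat.add_sub_cancel]
  set u := (1 + p) / 2 with hu'
  have hp : p = 2 * u - 1 := by rw [hu']; ring
  have e : 2 * (1 - p / u) / ((2 * u ^ (m + 1) - p ^ (m + 1)) / u ^ (m + 1))
      = 2 * (u - p) * u ^ m / (2 * u ^ (m + 1) - p ^ (m + 1)) := by
    rw [pow_succ u]; field_simp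
  rw [e, eq_sub_iff_add_eq, ← add_div, div_eq_one_iff_eq hd.ne']
  ring

theorem strictMonoOn_alphaFun {s : ℕ} (hs : 1 ≤ s) :
    StrictMonoOn (alphaFun s) (Set.Icc 0 1) := by
  intro p hp q hq hpq
  rw [alphaFun_eq hs hp.1 hp.2, alphaFun_eq hs hq.1 hq.2]
  have hp0 : 0 < 1 + p := by linarith [hp.1]
  have hq0 : 0 < 1 + q := by linarith [hq.1]
  set y := 2 * p / (1 + p) with hy
  set z := 2 * q / (1 + q) with hz
  have hy0 : 0 ≤ y := div_nonneg (by linarith [hp.1]) hp0.le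
  have hyz : y < z := by
    rw [hy, hz, div_lt_div_iff₀ hp0 hq0]; nlinarith
  have hz1 : z ≤ 1 := by
    rw [hz, div_le_one hq0]; linarith [hq.2]
  have hys : y ^ s ≤ 1 := pow_le_one₀ hy0 (by linarith)
  have hzs : z ^ s ≤ 1 := pow_le_one₀ (by linarith) hz1
  have gy : (∑ i ∈ Finset.range s, y ^ i) * (1 - y) = 1 - y ^ s := geom_sum_mul_neg y s
  have gz : (∑ i ∈ Finset.range s, z ^ i) * (1 - z) = 1 - z ^ s := geom_sum_mul_neg z s
  have hG : ∑ i ∈ Finset.range s, y ^ i ≤ ∑ i ∈ Finset.range s, z ^ i :=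
    Finset.sum_le_sum fun i _ => pow_le_pow_left₀ hy0 hyz.le i
  have key : 2 * (1 - z) / (2 - z ^ s) < 2 * (1 - y) / (2 - y ^ s) := by
    rw [div_lt_div_iff₀ (by linarith) (by linarith)]
    have h1 : 2 - y ^ s = 1 + (∑ i ∈ Finset.range s, y ^ i) * (1 - y) := by rw [gy]; ring
    have h2 : 2 - z ^ s = 1 + (∑ i ∈ Finset.range s, z ^ i) * (1 - z) := by rw [gz]; ring
    rw [h1, h2]
    have h3 : 0 ≤ (1 - z) * (1 - y) := mul_nonneg (by linarith) (by linarith)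
    nlinarith [mul_le_mul_of_nonneg_right hG h3]
  linarith

theorem bijOn_alphaFun {s : ℕ} (hs : 1 ≤ s) :
    Set.BijOn (alphaFun s) (Set.Ioo 0 1) (Set.Ioo 0 1) := by
  have h0 : alphaFun s 0 = 0 := by simp [alphaFun]
  have h1 : alphaFun s 1 = 1 := by norm_num [alphaFun]
  have hm := strictMonoOn_alphaFun hs
  refine ⟨fun p hp => ⟨?_, ?_⟩, (hm.mono Set.Ioo_subset_Icc_self).injOn, ?_⟩
  · rw [← h0]; exact hm (by simp) ⟨hp.1.le, hp.2.le⟩ hp.1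
  · rw [← h1]; exact hm ⟨hp.1.le, hp.2.le⟩ (by simp) hp.2
  · have hc : ContinuousOn (alphaFun s) (Set.Icc 0 1) := by
      unfold alphaFun
      refine ContinuousOn.div (by fun_prop) (by fun_prop) fun p hp => ?_
      exact (alphaFun_denom_pos s hp.1 hp.2).ne'
    have h := intermediate_value_Ioo (zero_le_one (α := ℝ)) hc
    rwa [h0, h1] at h

/-!
The members of a clique of the subcube intersection graph have a common point, because subcubes
satisfy Helly's theorem coordinate by coordinate: a set of subcubes is a clique if and only if in no
coordinate both values `0` and `1` are prescribed (`isClique_iff_compatible`,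
`exists_common_point`). Clique probabilities in the binomial model, in which every coordinate of
every subcube is independently `⋆` with probability `p`, are therefore `d`-th powers
(`sum_coordwise`). The uniform model is the binomial model conditioned on all dimensions being `k`,
for every choice of `p`.

*Cliques of bounded size.* Conditioning gives the upper bound `exp (-s d F_s(p))`, up to
`exp (o(d))`, for the probability that `s` given subcubes form a clique, for every `p`
(`eventually_clique_real_le`; `F_s` is `cliqueRate s α`). It is tight for `p = α_s⁻¹(α)`
(`eventually_clique_real_ge`): for `p` slightly below this value, binomial subcubes that form a
clique have dimensions slightly below `α d` by a Chernoff bound (`sum_clique_tail_le`), and freeing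
the few missing coordinates, which cannot destroy the clique, costs only `exp (o(d))`
(`sum_near_le`). Thus `T_{K_s}` is the maximum of `F_s`, and `T_{K_s} < T_{K_{s+1}}` follows from
`t_{K_s}(p) < t_{K_{s+1}}(p)`. Below `T_{K_s}` the expected number of `s`-cliques tends to zero.
Above it the second moment method applies: two `s`-cliques with `j` common members satisfy
`P ≤ exp (-(2s-j) d (T_{K_s} - o(1)))`, because the coordinatewise probability is log-convex in `j`
and so is dominated by the geometric interpolation between `j = 0` and `j = s`
(`pairPoly_log_convex`, `pairCompatProb_pow_le`).

*Above the covering threshold.* The number of subcubes that cover a given point is binomial with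
mean `m = |V| 2^{-(d-k)}`. If `m / d → ∞`, then with high probability `m/2 ≤ ω ≤ 6m`: the lower
bound is Chebyshev's inequality at one point, the upper bound is a union bound over the `2^d` points
(`coverMean_le_cliqueNum`, `cliqueNum_le_coverMean`).
-/

/-! ### Sums of product weights over families of subcubes -/

/-- The law of a single coordinate in the binomial model: the star has probability `p`, and each of
the two fixed values has probability `(1 - p) / 2`. -/
noncomputable def symbolWeight (p : ℝ) : Option Bool → ℝ
  | none => p
  | some _ => (1 - p) / 2

/-- The symbols that the members of `A` carry in one coordinate do not contain both fixed values. -/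
def Compatible {ι : Type*} (A : Finset ι) (τ : ι → Option Bool) : Prop :=
  ∀ u ∈ A, ∀ v ∈ A, τ u = some true → τ v ≠ some false

/-- `q_s(p) = 2((1+p)/2)^s - p^s`, the probability that `s` independent symbols of the binomial
model are compatible. -/
noncomputable def compatProb (s : ℕ) (p : ℝ) : ℝ := 2 * ((1 + p) / 2) ^ s - p ^ s

/-- The probability that two `s`-sets of independent symbols with `j` common members are both
compatible. -/
noncomputable def pairCompatProb (s j : ℕ) (p : ℝ) : ℝ :=
  2 * ((1 + p) / 2) ^ (2 * s - j) + 2 * (p ^ j * ((1 + p) / 2) ^ (2 * (s - j)))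
    - 4 * (p ^ s * ((1 + p) / 2) ^ (s - j)) + p ^ (2 * s - j)

theorem sum_prod_eq_prod_sum {κ β R : Type*} [Fintype κ] [DecidableEq κ] [Fintype β] [CommSemiring R]
    (W : κ → β → R) : ∑ c : κ → β, ∏ i, W i (c i) = ∏ i, ∑ o, W i o :=
  (Fintype.prod_sum _).symm

theorem sum_prod_coord {ι κ β R : Type*} [Fintype ι] [DecidableEq ι] [Fintype κ] [DecidableEq κ]
    [Fintype β] [CommSemiring R] (W : (ι → β) → R) :
    ∑ g : ι → κ → β, ∏ i, W (fun v => g v i) = (∑ τ, W τ) ^ Fintype.card κ := by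
  have h := sum_prod_eq_prod_sum (κ := κ) (fun _ => W)
  rw [Finset.prod_const, Finset.card_univ] at h
  rw [← h]
  exact Fintype.sum_equiv (Equiv.piComm fun _ _ => β) _ _ fun g => rfl

/-- Inclusion and exclusion: compatible symbols avoid `1` or avoid `0`, and avoid both exactly when
they are all stars. -/
theorem indicator_compatible {ι : Type*} (A : Finset ι) (τ : ι → Option Bool)
    [Decidable (Compatible A τ)] :
    (if Compatible A τ then (1 : ℝ) else 0)
      = ∏ v ∈ A, (if τ v ≠ some true then (1 : ℝ) else 0)
        + ∏ v ∈ A, (if τ v ≠ some false then (1 : ℝ) else 0)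
        - ∏ v ∈ A, (if τ v = none then (1 : ℝ) else 0) := by
  simp only [Finset.prod_ite_zero, Finset.prod_const_one]
  have key : ∀ o : Option Bool, o = none ↔ (o ≠ some true ∧ o ≠ some false) := by decide
  have h3 : (∀ i ∈ A, τ i = none) ↔ ((∀ i ∈ A, τ i ≠ some true) ∧ ∀ i ∈ A, τ i ≠ some false) :=
    ⟨fun h => ⟨fun i hi => ((key _).1 (h i hi)).1, fun i hi => ((key _).1 (h i hi)).2⟩,
      fun h i hi => (key _).2 ⟨h.1 i hi, h.2 i hi⟩⟩
  have hc : Compatible A τ ↔ ((∀ i ∈ A, τ i ≠ some true) ∨ ∀ i ∈ A, τ i ≠ some false) := by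
    constructor
    · intro h
      by_cases h1 : ∀ i ∈ A, τ i ≠ some true
      · exact Or.inl h1
      · push Not at h1
        obtain ⟨u, hu, hut⟩ := h1
        exact Or.inr fun v hv => h u hu v hv hut
    · rintro (h | h) u hu v hv huv
      · exact absurd huv (h u hu)
      · exact h v hv
  have gen : ∀ (P Q : Prop) [Decidable P] [Decidable Q] [Decidable (P ∨ Q)] [Decidable (P ∧ Q)],
      (if P ∨ Q then (1 : ℝ) else 0)
        = (if P then 1 else 0) + (if Q then 1 else 0) - (if P ∧ Q then 1 else 0) := by
    intro P Q _ _ _ _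
    by_cases h1 : P <;> by_cases h2 : Q <;> simp [h1, h2]
  simp only [h3, hc]
  exact gen _ _

open Classical in
theorem sum_compatible_univ {ι : Type*} [Fintype ι] (W : ι → Option Bool → ℝ) :
    ∑ τ : ι → Option Bool, (if Compatible Finset.univ τ then (1 : ℝ) else 0) * ∏ v, W v (τ v)
      = ∏ v, (W v none + W v (some false)) + ∏ v, (W v none + W v (some true))
        - ∏ v, W v none := by
  simp only [indicator_compatible, sub_mul, add_mul, ← Finset.prod_mul_distrib,
    Finset.sum_sub_distrib, Finset.sum_add_distrib]
  rw [sum_prod_eq_prod_sum (fun v o => (if o ≠ some true then (1 : ℝ) else 0) * W v o),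
    sum_prod_eq_prod_sum (fun v o => (if o ≠ some false then (1 : ℝ) else 0) * W v o),
    sum_prod_eq_prod_sum (fun v o => (if o = none then (1 : ℝ) else 0) * W v o)]
  simp [Fintype.sum_option]

open Classical in
theorem sum_prod_two_sets {ι : Type*} [Fintype ι] {A B : Finset ι}
    (hAB : A ∪ B = Finset.univ) {s j : ℕ} (hA : A.card = s) (hB : B.card = s)
    (hj : (A ∩ B).card = j) (g h w : Option Bool → ℝ) :
    ∑ τ : ι → Option Bool, (∏ v ∈ A, g (τ v)) * (∏ v ∈ B, h (τ v)) * ∏ v, w (τ v)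
      = (∑ o, g o * h o * w o) ^ j * (∑ o, g o * w o) ^ (s - j) * (∑ o, h o * w o) ^ (s - j) := by
  have hgen : ∀ (C : Finset ι) (f : Option Bool → ℝ) (τ : ι → Option Bool),
      ∏ v ∈ C, f (τ v) = ∏ v, if v ∈ C then f (τ v) else 1 := by
    intro C f τ
    rw [Finset.prod_ite_mem, Finset.univ_inter]
  simp only [hgen A, hgen B, ← Finset.prod_mul_distrib]
  rw [sum_prod_eq_prod_sum
    (fun v o => (if v ∈ A then g o else 1) * (if v ∈ B then h o else 1) * w o)]
  have hd : Disjoint (A ∩ B) (A \ B) := by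
    rw [Finset.disjoint_left]; intro a; simp +contextual
  have hd2 : Disjoint ((A ∩ B) ∪ (A \ B)) (B \ A) := by
    rw [Finset.disjoint_left]; intro a; simp; tauto
  have hu : (Finset.univ : Finset ι) = ((A ∩ B) ∪ (A \ B)) ∪ (B \ A) := by
    rw [← hAB]; ext a; simp; tauto
  have c1 : (A \ B).card = s - j := by rw [← hA, ← hj, Finset.card_sdiff, Finset.inter_comm]
  have c2 : (B \ A).card = s - j := by rw [← hB, ← hj, Finset.card_sdiff]
  rw [hu, Finset.prod_union hd2, Finset.prod_union hd]
  have main : ∀ (C : Finset ι) (a : ℝ) (n : ℕ) (F : ι → ℝ), C.card = n → (∀ v ∈ C, F v = a) →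
      ∏ v ∈ C, F v = a ^ n := fun C a n F hC hF => hC ▸ Finset.prod_eq_pow_card hF
  refine congr_arg₂ _ (congr_arg₂ _ (main _ _ _ _ hj fun v hv => ?_)
    (main _ _ _ _ c1 fun v hv => ?_)) (main _ _ _ _ c2 fun v hv => ?_) <;>
  · simp only [Finset.mem_sdiff, Finset.mem_inter] at hv
    simp [hv.1, hv.2]

open Classical in
theorem sum_compatible_pair {ι : Type*} [Fintype ι] {A B : Finset ι}
    (hAB : A ∪ B = Finset.univ) {s j : ℕ} (hA : A.card = s) (hB : B.card = s)
    (hj : (A ∩ B).card = j) (p : ℝ) :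
    ∑ τ : ι → Option Bool, (if Compatible A τ ∧ Compatible B τ then (1 : ℝ) else 0)
      * ∏ v, symbolWeight p (τ v) = pairCompatProb s j p := by
  have hjs : j ≤ s := by rw [← hj, ← hA]; exact Finset.card_le_card Finset.inter_subset_left
  have hite : ∀ τ : ι → Option Bool, (if Compatible A τ ∧ Compatible B τ then (1 : ℝ) else 0)
      = (if Compatible A τ then (1 : ℝ) else 0) * (if Compatible B τ then (1 : ℝ) else 0) := by
    intro τ
    by_cases h1 : Compatible A τ <;> by_cases h2 : Compatible B τ <;> simp [h1, h2]
  have hsum := sum_prod_two_sets hAB hA hB hj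
  set t : Option Bool → ℝ := fun o => if o ≠ some true then (1 : ℝ) else 0 with ht
  set f : Option Bool → ℝ := fun o => if o ≠ some false then (1 : ℝ) else 0 with hf
  set n : Option Bool → ℝ := fun o => if o = none then (1 : ℝ) else 0 with hn
  have e : ∀ τ : ι → Option Bool, (if Compatible A τ ∧ Compatible B τ then (1 : ℝ) else 0)
      * ∏ v, symbolWeight p (τ v) =
      (∏ v ∈ A, t (τ v)) * (∏ v ∈ B, t (τ v)) * ∏ v, symbolWeight p (τ v)
      + (∏ v ∈ A, t (τ v)) * (∏ v ∈ B, f (τ v)) * ∏ v, symbolWeight p (τ v)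
      - (∏ v ∈ A, t (τ v)) * (∏ v ∈ B, n (τ v)) * ∏ v, symbolWeight p (τ v)
      + ((∏ v ∈ A, f (τ v)) * (∏ v ∈ B, t (τ v)) * ∏ v, symbolWeight p (τ v)
      + (∏ v ∈ A, f (τ v)) * (∏ v ∈ B, f (τ v)) * ∏ v, symbolWeight p (τ v)
      - (∏ v ∈ A, f (τ v)) * (∏ v ∈ B, n (τ v)) * ∏ v, symbolWeight p (τ v))
      - ((∏ v ∈ A, n (τ v)) * (∏ v ∈ B, t (τ v)) * ∏ v, symbolWeight p (τ v)
      + (∏ v ∈ A, n (τ v)) * (∏ v ∈ B, f (τ v)) * ∏ v, symbolWeight p (τ v)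
      - (∏ v ∈ A, n (τ v)) * (∏ v ∈ B, n (τ v)) * ∏ v, symbolWeight p (τ v)) := by
    intro τ
    rw [hite, indicator_compatible, indicator_compatible]
    ring
  rw [Finset.sum_congr rfl fun τ _ => e τ]
  simp only [Finset.sum_sub_distrib, Finset.sum_add_distrib, hsum]
  have hu : p + (1 - p) / 2 = (1 + p) / 2 := by ring
  simp only [Fintype.sum_option, Fintype.sum_bool, ht, hf, hn, symbolWeight, pairCompatProb]
  obtain ⟨m, rfl⟩ := Nat.exists_eq_add_of_le hjs
  have e1 : j + m - j = m := by omega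
  have e2 : 2 * (j + m) - j = j + 2 * m := by omega
  simp [e1, e2, hu]
  ring

/-- The total weight of the families of subcubes that satisfy a constraint `Φ` in each coordinate
is a `d`-th power. -/
theorem sum_coordwise {ι : Type*} [Fintype ι] [DecidableEq ι] {d : ℕ}
    (Φ : (ι → Option Bool) → Prop) [DecidablePred Φ]
    (W : ι → Option Bool → ℝ) [DecidablePred fun g : ι → Subcube d => ∀ i, Φ fun v => g v i] :
    ∑ g : ι → Subcube d, (if ∀ i, Φ fun v => g v i then (1 : ℝ) else 0) * ∏ v, ∏ i, W v (g v i)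
      = (∑ τ : ι → Option Bool, (if Φ τ then (1 : ℝ) else 0) * ∏ v, W v (τ v)) ^ d := by
  have h := sum_prod_coord (κ := Fin d)
    (fun τ : ι → Option Bool => (if Φ τ then (1 : ℝ) else 0) * ∏ v, W v (τ v))
  rw [Fintype.card_fin] at h
  rw [← h]
  refine Finset.sum_congr rfl fun g _ => ?_
  rw [Finset.prod_mul_distrib, Finset.prod_comm, Finset.prod_ite_zero]
  simp

/-! ### The uniform model as a normalised sum -/

theorem Subcube.dim_le {d : ℕ} (c : Subcube d) : c.dim ≤ d := by
  unfold Subcube.dim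
  exact (Finset.card_le_univ _).trans (by simp)

theorem Subcube.prod_symbol {d : ℕ} (c : Subcube d) (x y : ℝ) :
    ∏ i : Fin d, (if (c i).isNone then x else y) = x ^ c.dim * y ^ (d - c.dim) := by
  rw [Finset.prod_ite, Finset.prod_const, Finset.prod_const]
  congr 2
  have h := Finset.card_filter_add_card_filter_not (s := (Finset.univ : Finset (Fin d)))
    (fun i => (c i).isNone = true)
  rw [Finset.card_univ, Fintype.card_fin] at h
  unfold Subcube.dim
  omega

theorem Subcube.prod_symbolWeight {d : ℕ} (c : Subcube d) (p : ℝ) :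
    ∏ i : Fin d, symbolWeight p (c i) = p ^ c.dim * ((1 - p) / 2) ^ (d - c.dim) := by
  rw [← Subcube.prod_symbol]
  refine Finset.prod_congr rfl fun i _ => ?_
  cases c i <;> simp [symbolWeight]

theorem Subcube.card_dim_eq (d k : ℕ) :
    (Finset.univ.filter fun c : Subcube d => c.dim = k).card = d.choose k * 2 ^ (d - k) := by
  -- The count is a coefficient of the generating polynomial `∑ c, X ^ dim c = (X + 2) ^ d`.
  have h := sum_prod_eq_prod_sum (κ := Fin d) (R := Polynomial ℕ)
    (fun _ (o : Option Bool) => if o.isNone then Polynomial.X else 1)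
  have h2 : (∏ _i : Fin d, ∑ o : Option Bool, (if o.isNone then Polynomial.X else 1 : Polynomial ℕ))
      = (Polynomial.X + Polynomial.C 2) ^ d := by
    simp [Fintype.sum_option, one_add_one_eq_two]
  rw [h2] at h
  have h3 := congrArg (fun P => Polynomial.coeff P k) h
  simp only [Polynomial.coeff_X_add_C_pow, Polynomial.finsetSum_coeff, Nat.cast_id] at h3
  rw [mul_comm, Finset.card_filter, ← h3]
  refine Finset.sum_congr rfl fun c _ => ?_
  rw [Finset.prod_ite, Finset.prod_const, Finset.prod_const, one_pow, mul_one,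
    Polynomial.coeff_X_pow]
  simp only [Subcube.dim, eq_comm]

open Classical in
theorem Subcube.card_dim_eq_mem (d k : ℕ) (y : Hypercube d) :
    (Finset.univ.filter fun c : Subcube d => c.dim = k ∧ y ∈ c.points).card = d.choose k := by
  have h := sum_prod_eq_prod_sum (κ := Fin d) (R := Polynomial ℕ)
    (fun i (o : Option Bool) => if o = none then Polynomial.X else if o = some (y i) then 1 else 0)
  have h2 : (∏ i : Fin d, ∑ o : Option Bool,
      (if o = none then Polynomial.X else if o = some (y i) then 1 else 0 : Polynomial ℕ))
      = (Polynomial.X + Polynomial.C 1) ^ d := by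
    have : ∀ i, ∑ o : Option Bool,
      (if o = none then Polynomial.X else if o = some (y i) then 1 else 0 : Polynomial ℕ)
      = Polynomial.X + Polynomial.C 1 := by
      intro i
      cases y i <;> simp [Fintype.sum_option]
    simp [this]
  rw [h2] at h
  have h3 := congrArg (fun P => Polynomial.coeff P k) h
  simp only [Polynomial.coeff_X_add_C_pow, Polynomial.finsetSum_coeff, one_pow, one_mul] at h3
  rw [Finset.card_filter, ← Nat.cast_id (d.choose k), ← h3]
  refine Finset.sum_congr rfl fun c _ => ?_
  by_cases hy : y ∈ c.points
  · have : ∀ i, (if c i = none then Polynomial.X else if c i = some (y i) then 1 else 0 :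
        Polynomial ℕ) = if (c i).isNone then Polynomial.X else 1 := by
      intro i
      cases hci : c i with
      | none => simp
      | some b => simp [hy i b hci]
    rw [Finset.prod_congr rfl fun i _ => this i, Finset.prod_ite, Finset.prod_const,
      Finset.prod_const, one_pow, mul_one, Polynomial.coeff_X_pow]
    simp only [Subcube.dim, eq_comm, hy, and_true]
  · have hy' := hy
    simp only [Subcube.points, Set.mem_ofPred_eq, not_forall] at hy'
    obtain ⟨i, b, hb, hne⟩ := hy'
    rw [Finset.prod_eq_zero (Finset.mem_univ i)]
    · simp [hy]
    · rw [hb]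
      simp [Ne.symm hne]

/-- The number of `k`-dimensional subcubes of `Q_d`. -/
def numSubcubes (d k : ℕ) : ℕ := d.choose k * 2 ^ (d - k)

/-- The probability that a random subcube of the binomial model with parameter `p` has
dimension `k`. -/
noncomputable def dimProb (d k : ℕ) (p : ℝ) : ℝ := d.choose k * p ^ k * (1 - p) ^ (d - k)

theorem numSubcubes_pos {d k : ℕ} (hk : k ≤ d) : 0 < numSubcubes d k :=
  Nat.mul_pos (Nat.choose_pos hk) (by positivity)

theorem dimProb_eq (d k : ℕ) (p : ℝ) :
    dimProb d k p = numSubcubes d k * (p ^ k * ((1 - p) / 2) ^ (d - k)) := by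
  unfold dimProb numSubcubes
  push_cast
  rw [div_pow]
  field_simp

theorem dimProb_pos {d k : ℕ} (hk : k ≤ d) {p : ℝ} (h0 : 0 < p) (h1 : p < 1) :
    0 < dimProb d k p := by
  have := Nat.choose_pos hk
  have : 0 < 1 - p := by linarith
  unfold dimProb; positivity

open Classical in
theorem uniformOn_real_dim {d k : ℕ} (A : Set (Subcube d)) :
    (ProbabilityTheory.uniformOn {c : Subcube d | c.dim = k}).real A
      = (Finset.univ.filter fun c : Subcube d => c.dim = k ∧ c ∈ A).card / numSubcubes d k := by
  have e1 : {c : Subcube d | c.dim = k}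
      = ((Finset.univ.filter fun c : Subcube d => c.dim = k : Finset _) : Set (Subcube d)) := by
    ext; simp
  have e2 : A = ((Finset.univ.filter fun c : Subcube d => c ∈ A : Finset _) : Set _) := by
    ext; simp
  rw [Measure.real, e1]
  nth_rewrite 1 [e2]
  rw [ProbabilityTheory.uniformOn_apply_finset, Subcube.card_dim_eq, ← Finset.filter_and,
    ENNReal.toReal_div]
  simp [numSubcubes]

open Classical in
theorem uniformOn_real_singleton {d k : ℕ} (c : Subcube d) :
    (ProbabilityTheory.uniformOn {c : Subcube d | c.dim = k}).real {c}
      = if c.dim = k then 1 / (numSubcubes d k : ℝ) else 0 := by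
  rw [uniformOn_real_dim]
  by_cases h : c.dim = k
  · rw [if_pos h, Finset.card_eq_one.2 ⟨c, ?_⟩, Nat.cast_one]
    ext c'
    simp only [Finset.mem_filter, Finset.mem_univ, true_and, Set.mem_singleton_iff,
      Finset.mem_singleton]
    exact ⟨fun h => h.2, fun h' => ⟨h' ▸ h, h'⟩⟩
  · rw [if_neg h, Finset.card_eq_zero.2, Nat.cast_zero, zero_div]
    ext c'
    simp only [Finset.mem_filter, Finset.mem_univ, true_and, Set.mem_singleton_iff,
      Finset.notMem_empty, iff_false]
    rintro ⟨h1, rfl⟩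
    exact h h1

theorem isProbabilityMeasure_uniformOn_dim {d k : ℕ} (hk : k ≤ d) :
    IsProbabilityMeasure (ProbabilityTheory.uniformOn {c : Subcube d | c.dim = k}) :=
  ProbabilityTheory.isProbabilityMeasure_uniformOn (Set.toFinite _) (Subcube.exists_dim_eq hk)

open Classical in
theorem uniformModel_real {ι : Type*} [Fintype ι] {d k : ℕ} (hk : k ≤ d)
    (E : Set (ι → Subcube d)) :
    (uniformModel ι d k).real E = ∑ g : ι → Subcube d, (if g ∈ E then (1 : ℝ) else 0)
      * ∏ v, if (g v).dim = k then 1 / (numSubcubes d k : ℝ) else 0 := by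
  have := isProbabilityMeasure_uniformOn_dim hk
  have := isProbabilityMeasure_uniformModel ι hk
  have e2 : E = ((Finset.univ.filter fun c => c ∈ E : Finset _) : Set _) := by
    ext; simp
  conv_lhs => rw [e2]
  rw [← sum_measureReal_singleton, Finset.sum_filter]
  refine Finset.sum_congr rfl fun g _ => ?_
  by_cases hg : g ∈ E
  · simp only [hg, if_true, one_mul]
    rw [Measure.real, uniformModel, Measure.pi_singleton, ENNReal.toReal_prod]
    exact Finset.prod_congr rfl fun v _ => uniformOn_real_singleton _
  · simp [hg]

open Classical in
/-- Conditioning the binomial model on all dimensions being `k` gives the uniform model; a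
probability grows by at most the inverse of the probability of the condition. -/
theorem uniformModel_real_le {ι : Type*} [Fintype ι] {d k : ℕ} (hk : k ≤ d)
    (Φ : (ι → Option Bool) → Prop) {p : ℝ} (h0 : 0 < p) (h1 : p < 1) :
    (uniformModel ι d k).real {g | ∀ i, Φ fun v => g v i}
      ≤ (∑ τ : ι → Option Bool, (if Φ τ then (1 : ℝ) else 0) * ∏ v, symbolWeight p (τ v)) ^ d
        / dimProb d k p ^ Fintype.card ι := by
  rw [uniformModel_real hk, ← sum_coordwise Φ (fun _ => symbolWeight p), Finset.sum_div]
  have hb := dimProb_pos hk h0 h1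
  have hr : 0 < (1 - p) / 2 := by linarith
  refine Finset.sum_le_sum fun g _ => ?_
  rw [mul_div_assoc, ← Finset.card_univ, ← Finset.prod_const, ← Finset.prod_div_distrib]
  by_cases hg : ∀ i, Φ fun v => g v i
  swap
  · rw [if_neg hg, zero_mul, if_neg (by exact hg), zero_mul]
  rw [if_pos hg, one_mul, if_pos (by exact hg), one_mul]
  refine Finset.prod_le_prod (fun v _ => by split_ifs <;> positivity) fun v _ => ?_
  rw [Subcube.prod_symbolWeight]
  have hn : (0 : ℝ) < numSubcubes d k := by exact_mod_cast numSubcubes_pos hk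
  split_ifs with hv
  · rw [hv, dimProb_eq]
    apply le_of_eq
    field_simp
  · positivity

/-! ### Cliques and compatibility -/

theorem points_inter_nonempty_iff {d : ℕ} (c c' : Subcube d) :
    (c.points ∩ c'.points).Nonempty ↔ ∀ i b, c i = some b → c' i ≠ some !b := by
  constructor
  · rintro ⟨x, h1, h2⟩ i b hb hb'
    have := (h1 i b hb).symm.trans (h2 i _ hb')
    simp at this
  · intro h
    refine ⟨fun i => ((c i).or (c' i)).getD false, fun i b hb => by simp [hb], fun i b hb => ?_⟩
    cases hc : c i with
    | none => simp [hc, hb]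
    | some a =>
      have := h i a hc
      rw [hb] at this
      cases a <;> cases b <;> simp_all

theorem isClique_iff_compatible {V : Type*} {d : ℕ} (f : V → Subcube d) (A : Finset V) :
    (subcubeGraph f).IsClique A ↔ ∀ i, Compatible A fun v => f v i := by
  constructor
  · intro h i u hu v hv hut hvf
    have huv : u ≠ v := by
      rintro rfl
      rw [hut] at hvf
      simp at hvf
    have := ((points_inter_nonempty_iff _ _).1 (h hu hv huv).2) i true hut
    exact this hvf
  · intro h u hu v hv huv
    refine ⟨huv, (points_inter_nonempty_iff _ _).2 fun i b hb hb' => ?_⟩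
    cases b
    · exact h i v hv u hu hb' hb
    · exact h i u hu v hv hb hb'

/-- Helly's theorem for subcubes: the members of a clique have a common point. -/
theorem exists_common_point {V : Type*} {d : ℕ} (f : V → Subcube d) {A : Finset V}
    (h : (subcubeGraph f).IsClique A) : ∃ y : Hypercube d, ∀ v ∈ A, y ∈ (f v).points := by
  classical
  rw [isClique_iff_compatible] at h
  refine ⟨fun i => decide (∃ u ∈ A, f u i = some true), fun v hv i b hb => ?_⟩
  cases b
  · simp only [decide_eq_false_iff_not, not_exists, not_and]
    exact fun u hu hut => h i u hu v hv hut hb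
  · simp only [decide_eq_true_eq]
    exact ⟨v, hv, hb⟩

theorem isClique_of_common_point {V : Type*} {d : ℕ} (f : V → Subcube d) {A : Finset V}
    {y : Hypercube d} (h : ∀ v ∈ A, y ∈ (f v).points) : (subcubeGraph f).IsClique A :=
  fun u hu v hv huv => ⟨huv, y, h u hu, h v hv⟩

theorem le_cliqueNum_iff {V : Type*} [Finite V] (G : SimpleGraph V) (s : ℕ) :
    s ≤ G.cliqueNum ↔ ∃ A : Finset V, A.card = s ∧ G.IsClique A := by
  constructor
  · intro h
    obtain ⟨t, ht⟩ := G.exists_isNClique_cliqueNum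
    obtain ⟨A, hA, hc⟩ := Finset.exists_subset_card_eq (s := t) (n := s) (by rw [ht.card_eq]; exact h)
    exact ⟨A, hc, ht.isClique.subset (by exact_mod_cast hA)⟩
  · rintro ⟨A, rfl, hA⟩
    exact SimpleGraph.IsClique.card_le_cliqueNum (tc := hA)

/-! ### Marginals and independence in the uniform model -/

/-- The marginal of the uniform model on a set of vertices is again the uniform model. -/
theorem uniformModel_real_restrict {V : Type*} [Fintype V] {d k : ℕ} (hk : k ≤ d) (U : Finset V)
    (E : Set (U → Subcube d)) :
    (uniformModel V d k).real {f | (fun v : U => f v) ∈ E} = (uniformModel U d k).real E := by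
  classical
  have := isProbabilityMeasure_uniformOn_dim hk
  have h := measurePreserving_piEquivPiSubtypeProd (ι := V)
    (fun _ => ProbabilityTheory.uniformOn {c : Subcube d | c.dim = k}) (fun v => v ∈ U)
  have h2 := measurePreserving_fst.comp h
  have h3 := h2.measure_preimage (s := E) (MeasurableSet.of_discrete.nullMeasurableSet)
  unfold uniformModel Measure.real
  refine congrArg _ (Eq.trans ?_ (h3.trans ?_))
  · rfl
  · congr!

theorem uniformModel_real_inter {V : Type*} [Fintype V] {d k : ℕ} (hk : k ≤ d) {A B : Finset V}
    (hAB : Disjoint A B) (E : Set (A → Subcube d)) (F : Set (B → Subcube d)) :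
    (uniformModel V d k).real {f | (fun v : A => f v) ∈ E ∧ (fun v : B => f v) ∈ F}
      = (uniformModel V d k).real {f | (fun v : A => f v) ∈ E}
        * (uniformModel V d k).real {f | (fun v : B => f v) ∈ F} := by
  have := isProbabilityMeasure_uniformOn_dim hk
  have h := ProbabilityTheory.iIndepFun_pi (ι := V)
    (μ := fun _ => ProbabilityTheory.uniformOn {c : Subcube d | c.dim = k})
    (X := fun _ c => c) (fun _ => aemeasurable_id)
  have h2 := h.indepFun_finset A B hAB (fun v => measurable_pi_apply v)
  have h3 := h2.measure_inter_preimage_eq_mul (s := E) (t := F) .of_discrete .of_discrete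
  unfold uniformModel Measure.real
  rw [← ENNReal.toReal_mul]
  exact congrArg _ h3

/-! ### Convexity of the clique probabilities -/

/-- A sequence that is convex on `{0, …, s}` lies below its chord. -/
theorem mul_le_of_discrete_convex {a : ℕ → ℝ} {s : ℕ}
    (h : ∀ j, j + 2 ≤ s → 2 * a (j + 1) ≤ a j + a (j + 2)) {j : ℕ} (hj : j ≤ s) :
    s * a j ≤ (s - j) * a 0 + j * a s := by
  have h1 : ∀ m : ℕ, m + 1 ≤ s → (m + 1) * a m ≤ a 0 + m * a (m + 1) := by
    intro m
    induction m with
    | zero => intro _; simp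
    | succ m ih =>
      intro hm
      have h2 := mul_le_mul_of_nonneg_left (h m (by omega)) (by positivity : (0 : ℝ) ≤ m + 1)
      have h3 := ih (by omega)
      push_cast
      rw [show m + 1 + 1 = m + 2 from rfl]
      linarith
  suffices ∀ n, j ≤ n → n ≤ s → n * a j ≤ (n - j) * a 0 + j * a n from this s hj le_rfl
  intro n hjn
  induction n, hjn using Nat.le_induction with
  | base => intro _; simp
  | succ n hn ih =>
    intro hns
    have h2 := ih (by omega)
    have h3 := h1 n hns
    rcases Nat.eq_zero_or_pos n with rfl | hpos
    · obtain rfl : j = 0 := by omega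
      simp
    · have hn' : (0 : ℝ) < n := by exact_mod_cast hpos
      have hj0 : (0 : ℝ) ≤ j := by positivity
      push_cast
      refine le_of_mul_le_mul_left ?_ hn'
      have h4 := mul_le_mul_of_nonneg_left h2 (by positivity : (0 : ℝ) ≤ n + 1)
      have h5 := mul_le_mul_of_nonneg_left h3 hj0
      linarith

/-- Up to the factor `((1+p)/2)^(2s-j)`, the probability `pairCompatProb s j p`, as a function of
`y = 2p/(1+p)`. -/
def pairPoly (y : ℝ) (s j : ℕ) : ℝ := 2 + 2 * y ^ j - 4 * y ^ s + y ^ (2 * s - j)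

theorem pairPoly_pos {y : ℝ} (h0 : 0 < y) (h1 : y < 1) {s j : ℕ} (hj : j ≤ s) :
    0 < pairPoly y s j := by
  obtain ⟨m, rfl⟩ := Nat.exists_eq_add_of_le hj
  have e : 2 * (j + m) - j = j + 2 * m := by omega
  have hx : y ^ j ≤ 1 := pow_le_one₀ h0.le h1.le
  have hx0 : 0 < y ^ j := by positivity
  have hz : y ^ m ≤ 1 := pow_le_one₀ h0.le h1.le
  have : pairPoly y (j + m) j = 2 * (1 - y ^ j) + y ^ j * (2 - y ^ m) ^ 2 := by
    unfold pairPoly; rw [e]; ring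
  rw [this]
  have : 0 < y ^ j * (2 - y ^ m) ^ 2 := mul_pos hx0 (pow_pos (by linarith) 2)
  linarith

/-- The difference of the two sides is `(1-y)²` times a factor in which only `2 - 4 y^s` can be
negative. -/
theorem pairPoly_log_convex {y : ℝ} (h0 : 0 < y) (h1 : y < 1) {s j : ℕ} (hj : j + 2 ≤ s) :
    pairPoly y s (j + 1) ^ 2 ≤ pairPoly y s j * pairPoly y s (j + 2) := by
  obtain ⟨m, rfl⟩ := Nat.exists_eq_add_of_le hj
  have e0 : 2 * (j + 2 + m) - j = (j + 2 + m) + 2 + m := by omega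
  have e1 : 2 * (j + 2 + m) - (j + 1) = (j + 2 + m) + 1 + m := by omega
  have e2 : 2 * (j + 2 + m) - (j + 2) = (j + 2 + m) + m := by omega
  unfold pairPoly
  rw [e0, e1, e2]
  have hx0 : 0 < y ^ j := by positivity
  have hx1 : y ^ j ≤ 1 := pow_le_one₀ h0.le h1.le
  have hz0 : 0 < y ^ m := by positivity
  have hz1 : y ^ m ≤ 1 := pow_le_one₀ h0.le h1.le
  have hY : y ^ (j + 2 + m) = y ^ j * y ^ 2 * y ^ m := by ring
  simp only [pow_add _ (j + 2 + m + 2), pow_add _ (j + 2 + m + 1), pow_add _ (j + 2 + m),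
    pow_add y j, pow_one] at *
  generalize y ^ j = x at *
  generalize y ^ m = z at *
  set Y := x * y ^ 2 * z with hYd
  have hY0 : 0 < Y := by positivity
  have hxy : x * y ≤ 1 := by nlinarith
  have hyz : y * z ≤ 1 := by nlinarith
  have hY1 : Y ≤ 1 := by
    have : Y = (x * y) * (y * z) := by rw [hYd]; ring
    rw [this]
    exact mul_le_one₀ hxy (by positivity) hyz
  -- With `w = x y ∈ [Y, 1]`, the quantity `y (2x + Yz) = 2w + Y²/w` is at most `2 + Y²`, its value
  -- at `w = 1`; a cubic inequality in `Y` remains.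
  have key : 0 ≤ (2 - 4 * Y) * (2 * x + Y * z) + 2 * x * Y * z * (1 + y) ^ 2 := by
    have hp : 0 < 2 * x + Y * z := by positivity
    by_cases hc : 0 ≤ 2 - 4 * Y
    · have := mul_nonneg hc hp.le
      positivity
    · push Not at hc
      refine le_of_mul_le_mul_left ?_ h0
      have h3 : y * (2 * x + Y * z) ≤ 2 + Y ^ 2 := by
        have hw : (y * z) ^ 2 ≤ 1 := pow_le_one₀ (by positivity) hyz
        have h4 : 0 ≤ (1 - x * y) * (2 - (x * y) * (y * z) ^ 2) := by
          refine mul_nonneg (by linarith) ?_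
          have : (x * y) * (y * z) ^ 2 ≤ 1 := mul_le_one₀ hxy (by positivity) hw
          linarith
        rw [hYd]; nlinarith
      have h5 : 8 * Y ^ 2 ≤ y * (2 * x * Y * z * (1 + y) ^ 2) := by
        have : y * (2 * x * Y * z * (1 + y) ^ 2) - 8 * Y ^ 2
            = 2 * x * Y * z * y * (1 - y) ^ 2 := by rw [hYd]; ring
        have h6 : 0 ≤ 2 * x * Y * z * y * (1 - y) ^ 2 := by positivity
        linarith
      have h7 : (2 - 4 * Y) * (2 + Y ^ 2) ≤ (2 - 4 * Y) * (y * (2 * x + Y * z)) :=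
        mul_le_mul_of_nonpos_left h3 hc.le
      have h8 : 0 ≤ (2 - 4 * Y) * (2 + Y ^ 2) + 8 * Y ^ 2 := by
        nlinarith [mul_nonneg hY0.le (sq_nonneg (Y - 1)), sq_nonneg (Y - 1)]
      nlinarith
  have hid : ∀ Y : ℝ, (2 + 2 * x - 4 * Y + Y * y ^ 2 * z)
      * (2 + 2 * (x * y ^ 2) - 4 * Y + Y * z) - (2 + 2 * (x * y) - 4 * Y + Y * y * z) ^ 2
      = (1 - y) ^ 2 * ((2 - 4 * Y) * (2 * x + Y * z) + 2 * x * Y * z * (1 + y) ^ 2) := by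
    intro Y; ring
  have h9 := mul_nonneg (sq_nonneg (1 - y)) key
  rw [← hid] at h9
  rw [hY]
  linarith

theorem pairPoly_pow_le {y : ℝ} (h0 : 0 < y) (h1 : y < 1) {s j : ℕ} (hj : j ≤ s) :
    pairPoly y s j ^ s ≤ (2 - y ^ s) ^ (2 * s - j) := by
  have hys : y ^ s ≤ 1 := pow_le_one₀ h0.le h1.le
  have hq : 0 < 2 - y ^ s := by linarith
  have hconv := mul_le_of_discrete_convex (a := fun i => Real.log (pairPoly y s i)) (s := s)
    (fun i hi => by
      have h2 := pairPoly_log_convex h0 h1 hi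
      have p1 := pairPoly_pos h0 h1 (show i ≤ s by omega)
      have p2 := pairPoly_pos h0 h1 (show i + 1 ≤ s by omega)
      have p3 := pairPoly_pos h0 h1 hi
      have h3 := Real.log_le_log (by positivity) h2
      rw [Real.log_pow, Real.log_mul p1.ne' p3.ne'] at h3
      exact_mod_cast h3) hj
  have e0 : pairPoly y s 0 = (2 - y ^ s) ^ 2 := by
    unfold pairPoly; rw [Nat.sub_zero, mul_comm 2 s, pow_mul]; ring
  have es : pairPoly y s s = 2 - y ^ s := by
    unfold pairPoly; rw [show 2 * s - s = s by omega]; ring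
  simp only [e0, es, Real.log_pow] at hconv
  have pj := pairPoly_pos h0 h1 hj
  rw [← Real.log_le_log_iff (by positivity) (by positivity), Real.log_pow, Real.log_pow,
    Nat.cast_sub (by omega)]
  push_cast at hconv ⊢
  linarith

theorem compatProb_eq {p : ℝ} (h0 : 0 < p) (s : ℕ) :
    compatProb s p = ((1 + p) / 2) ^ s * (2 - (2 * p / (1 + p)) ^ s) := by
  have hu : 0 < (1 + p) / 2 := by positivity
  have hp : p = ((1 + p) / 2) * (2 * p / (1 + p)) := by field_simp
  unfold compatProb
  nth_rewrite 2 [hp]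
  rw [mul_pow]
  ring

theorem compatProb_pos {p : ℝ} (h0 : 0 < p) (h1 : p < 1) (s : ℕ) : 0 < compatProb s p :=
  alphaFun_denom_pos s h0.le h1.le

/-- Two `s`-cliques with `j` common members are jointly at most as likely, per vertex, as a single
`s`-clique: balancedness of the union of two cliques. -/
theorem pairCompatProb_pow_le {p : ℝ} (h0 : 0 < p) (h1 : p < 1) {s j : ℕ} (hj : j ≤ s) :
    0 < pairCompatProb s j p ∧
      pairCompatProb s j p ^ s ≤ compatProb s p ^ (2 * s - j) := by
  have hu : 0 < (1 + p) / 2 := by positivity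
  have hy0 : 0 < 2 * p / (1 + p) := by positivity
  have hy1 : 2 * p / (1 + p) < 1 := by rw [div_lt_one (by positivity)]; linarith
  have hp : p = ((1 + p) / 2) * (2 * p / (1 + p)) := by field_simp
  have e : pairCompatProb s j p = ((1 + p) / 2) ^ (2 * s - j) * pairPoly (2 * p / (1 + p)) s j := by
    obtain ⟨m, rfl⟩ := Nat.exists_eq_add_of_le hj
    have e1 : 2 * (j + m) - j = j + 2 * m := by omega
    have e2 : j + m - j = m := by omega
    have gen : ∀ u y : ℝ, 2 * u ^ (j + 2 * m) + 2 * ((u * y) ^ j * u ^ (2 * m))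
        - 4 * ((u * y) ^ (j + m) * u ^ m) + (u * y) ^ (j + 2 * m)
        = u ^ (j + 2 * m) * (2 + 2 * y ^ j - 4 * y ^ (j + m) + y ^ (j + 2 * m)) := by
      intro u y
      simp only [mul_pow]
      ring
    have h := gen ((1 + p) / 2) (2 * p / (1 + p))
    rw [← hp] at h
    unfold pairCompatProb pairPoly
    rw [e1, e2]
    exact h
  refine ⟨by rw [e]; exact mul_pos (by positivity) (pairPoly_pos hy0 hy1 hj), ?_⟩
  rw [e, compatProb_eq h0, mul_pow, mul_pow, ← pow_mul, ← pow_mul, mul_comm s]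
  exact mul_le_mul_of_nonneg_left (pairPoly_pow_le hy0 hy1 hj) (by positivity)

/-- A case of Young's inequality. -/
theorem succ_mul_pow_le {y : ℝ} (h0 : 0 ≤ y) (h1 : y ≤ 1) (s : ℕ) :
    (s + 1) * y ^ s ≤ 1 + s * y ^ (s + 1) := by
  induction s with
  | zero => simp
  | succ s ih =>
    have h2 : y ^ (s + 1) ≤ 1 := pow_le_one₀ h0 h1
    have h3 := mul_le_mul_of_nonneg_left ih h0
    have h4 : 0 ≤ (1 - y) * (1 - y ^ (s + 1)) := mul_nonneg (by linarith) (by linarith)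
    push_cast
    have e1 : y * ((s + 1) * y ^ s) = (s + 1) * y ^ (s + 1) := by ring
    have e2 : y ^ (s + 1 + 1) = y * y ^ (s + 1) := by ring
    rw [e1] at h3
    rw [e2]
    nlinarith

/-- With `y = 2p/(1+p)` this is the strict inequality `(2 - y^(s+1))^s < (2 - y^s)^(s+1)`, which
follows from the concavity of `n ↦ log (2 - y^n)`. -/
theorem tClique_lt_succ {p : ℝ} (h0 : 0 < p) (h1 : p < 1) {s : ℕ} (hs : 1 ≤ s) :
    tClique s p < tClique (s + 1) p := by
  have hu : 0 < (1 + p) / 2 := by positivity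
  have hs' : (0 : ℝ) < s := by exact_mod_cast hs
  have hy0 : 0 < 2 * p / (1 + p) := by positivity
  have hy1 : 2 * p / (1 + p) < 1 := by rw [div_lt_one (by positivity)]; linarith
  have e : ∀ n, Real.log (compatProb n p)
      = n * Real.log ((1 + p) / 2) + Real.log (2 - (2 * p / (1 + p)) ^ n) := by
    intro n
    have : (2 * p / (1 + p)) ^ n ≤ 1 := pow_le_one₀ hy0.le hy1.le
    rw [compatProb_eq h0, Real.log_mul (by positivity) (by linarith), Real.log_pow]
  have key : s * Real.log (compatProb (s + 1) p) < (s + 1) * Real.log (compatProb s p) := by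
    rw [e, e]
    set y := 2 * p / (1 + p)
    have hy2 : y ^ (s + 1) < 1 := pow_lt_one₀ hy0.le hy1 (by omega)
    have hs1 : (1 / (s + 1) : ℝ) + s / (s + 1) = 1 := by field_simp; ring
    have hcc := strictConcaveOn_log_Ioi.2 (show (1 : ℝ) ∈ Set.Ioi 0 by simp)
      (show 2 - y ^ (s + 1) ∈ Set.Ioi (0 : ℝ) by simp only [Set.mem_Ioi]; linarith)
      (by linarith) (show (0 : ℝ) < 1 / (s + 1) by positivity)
      (show (0 : ℝ) < s / (s + 1) by positivity) hs1
    simp only [smul_eq_mul, Real.log_one, mul_zero, zero_add] at hcc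
    have h3 : 1 / (s + 1 : ℝ) * 1 + s / (s + 1) * (2 - y ^ (s + 1)) ≤ 2 - y ^ s := by
      have := succ_mul_pow_le hy0.le hy1.le s
      have e4 : 1 / (s + 1 : ℝ) * 1 + s / (s + 1) * (2 - y ^ (s + 1))
        = (1 + s * (2 - y ^ (s + 1))) / (s + 1) := by ring
      rw [e4, div_le_iff₀ (by positivity)]
      linarith
    have h4 := hcc.trans_le (Real.log_le_log
      (by have : 0 < s / (s + 1 : ℝ) * (2 - y ^ (s + 1)) := mul_pos (by positivity) (by linarith)
          positivity) h3)
    rw [div_mul_eq_mul_div, div_lt_iff₀ (by positivity)] at h4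
    push_cast
    linarith
  unfold tClique
  change -(1 / (s : ℝ)) * Real.log (compatProb s p)
    < -(1 / ((s + 1 : ℕ) : ℝ)) * Real.log (compatProb (s + 1) p)
  rw [neg_mul, neg_mul, neg_lt_neg_iff, one_div_mul_eq_div, one_div_mul_eq_div,
    div_lt_div_iff₀ (by positivity) hs']
  push_cast
  linarith

/-! ### The exponential rate of the binomial probabilities -/

/-- Stirling's formula on the logarithmic scale. -/
theorem tendsto_log_factorial :
    Tendsto (fun n : ℕ => Real.log (n.factorial : ℝ) / n - Real.log n + 1) atTop (𝓝 0) := by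
  have h1 : Tendsto (fun n : ℕ => Real.log (Stirling.stirlingSeq n)) atTop
      (𝓝 (Real.log (Real.sqrt Real.pi))) :=
    Stirling.tendsto_stirlingSeq_sqrt_pi.log (by positivity)
  have hn : Tendsto (fun n : ℕ => (n : ℝ)) atTop atTop := tendsto_natCast_atTop_atTop
  have h2 : Tendsto (fun n : ℕ => Real.log (Stirling.stirlingSeq n) / n) atTop (𝓝 0) :=
    h1.div_atTop hn
  have h3 : Tendsto (fun n : ℕ => Real.log (2 * (n : ℝ)) / (2 * n)) atTop (𝓝 0) :=
    (Real.isLittleO_log_id_atTop.tendsto_div_nhds_zero).comp (hn.const_mul_atTop two_pos)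
  have h4 := h2.add h3
  rw [add_zero] at h4
  refine h4.congr' ?_
  filter_upwards [eventually_gt_atTop 0] with n hn0
  have hn' : (0 : ℝ) < n := by exact_mod_cast hn0
  rw [Stirling.log_stirlingSeq_formula, Real.log_div hn'.ne' (Real.exp_pos 1).ne', Real.log_exp]
  field_simp
  ring

/-- The exponential rate of `dimProb d ⌊αd⌋ p`, the negative of a relative entropy. -/
noncomputable def dimRate (α p : ℝ) : ℝ :=
  α * Real.log (p / α) + (1 - α) * Real.log ((1 - p) / (1 - α))

theorem floor_le {α : ℝ} (h0 : 0 < α) (h1 : α < 1) (d : ℕ) : ⌊α * (d : ℝ)⌋₊ ≤ d := by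
  have : α * (d : ℝ) ≤ d := by nlinarith [Nat.cast_nonneg (α := ℝ) d]
  exact_mod_cast (Nat.floor_le (by positivity)).trans this

theorem tendsto_log_dimProb {α p : ℝ} (hα0 : 0 < α) (hα1 : α < 1) (h0 : 0 < p) (h1 : p < 1) :
    Tendsto (fun d : ℕ => Real.log (dimProb d ⌊α * (d : ℝ)⌋₊ p) / d) atTop (𝓝 (dimRate α p)) := by
  have hkd : Tendsto (fun d : ℕ => (⌊α * (d : ℝ)⌋₊ : ℝ) / d) atTop (𝓝 α) :=
    (tendsto_nat_floor_mul_div_atTop hα0.le).comp tendsto_natCast_atTop_atTop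
  have hk : Tendsto (fun d : ℕ => ⌊α * (d : ℝ)⌋₊) atTop atTop :=
    tendsto_nat_floor_atTop.comp (tendsto_natCast_atTop_atTop.const_mul_atTop hα0)
  have hdk : Tendsto (fun d : ℕ => d - ⌊α * (d : ℝ)⌋₊) atTop atTop := by
    have h : Tendsto (fun d : ℕ => (1 - α) * (d : ℝ)) atTop atTop :=
      tendsto_natCast_atTop_atTop.const_mul_atTop (by linarith)
    rw [← tendsto_natCast_atTop_iff (R := ℝ)]
    refine tendsto_atTop_mono (fun d => ?_) h
    rw [Nat.cast_sub (floor_le hα0 hα1 d)]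
    have := Nat.floor_le (a := α * (d : ℝ)) (by positivity)
    linarith
  have hε := tendsto_log_factorial
  set ε : ℕ → ℝ := fun n => Real.log (n.factorial : ℝ) / n - Real.log n + 1 with hεd
  have hlim : Tendsto (fun d : ℕ => ε d - ((⌊α * (d : ℝ)⌋₊ : ℝ) / d) * ε ⌊α * (d : ℝ)⌋₊
      - (1 - (⌊α * (d : ℝ)⌋₊ : ℝ) / d) * ε (d - ⌊α * (d : ℝ)⌋₊)
      + ((⌊α * (d : ℝ)⌋₊ : ℝ) / d) * (Real.log p - Real.log ((⌊α * (d : ℝ)⌋₊ : ℝ) / d))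
      + (1 - (⌊α * (d : ℝ)⌋₊ : ℝ) / d) * (Real.log (1 - p)
        - Real.log (1 - (⌊α * (d : ℝ)⌋₊ : ℝ) / d))) atTop
      (𝓝 (0 - α * 0 - (1 - α) * 0 + α * (Real.log p - Real.log α)
        + (1 - α) * (Real.log (1 - p) - Real.log (1 - α)))) := by
    have h1k := (tendsto_const_nhds (x := (1 : ℝ))).sub hkd
    exact (((hε.sub (hkd.mul (hε.comp hk))).sub (h1k.mul (hε.comp hdk))).add
      (hkd.mul (tendsto_const_nhds.sub (hkd.log hα0.ne')))).add
      (h1k.mul (tendsto_const_nhds.sub (h1k.log (by linarith))))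
  have e : dimRate α p = 0 - α * 0 - (1 - α) * 0 + α * (Real.log p - Real.log α)
        + (1 - α) * (Real.log (1 - p) - Real.log (1 - α)) := by
    unfold dimRate
    rw [Real.log_div h0.ne' hα0.ne', Real.log_div (by linarith) (by linarith)]
    ring
  rw [e]
  refine hlim.congr' ?_
  filter_upwards [eventually_gt_atTop 0, hk.eventually_gt_atTop 0, hdk.eventually_gt_atTop 0]
    with d hd hkp hdkp
  have hle := floor_le hα0 hα1 d
  generalize ⌊α * (d : ℝ)⌋₊ = k at *
  obtain ⟨m, rfl⟩ := Nat.exists_eq_add_of_le hle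
  rw [Nat.add_sub_cancel_left] at hdkp ⊢
  have hk' : (0 : ℝ) < k := by exact_mod_cast hkp
  have hm' : (0 : ℝ) < m := by exact_mod_cast hdkp
  have hp1 : 0 < 1 - p := by linarith
  have hc0 : 0 < ((k + m).choose k : ℝ) := by
    exact_mod_cast Nat.choose_pos (show k ≤ k + m by omega)
  have hc : Real.log ((k + m).choose k : ℝ)
      = Real.log ((k + m).factorial) - Real.log k.factorial - Real.log m.factorial := by
    have h := Nat.choose_mul_factorial_mul_factorial (show k ≤ k + m by omega)
    rw [Nat.add_sub_cancel_left] at h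
    have h2 : ((k + m).choose k : ℝ) * k.factorial * m.factorial = (k + m).factorial := by
      exact_mod_cast h
    rw [← h2, Real.log_mul, Real.log_mul]
    · ring
    all_goals positivity
  unfold dimProb
  rw [Nat.add_sub_cancel_left, Real.log_mul, Real.log_mul, Real.log_pow, Real.log_pow, hc]
  · have e1 : 1 - (k : ℝ) / ((k + m : ℕ) : ℝ) = m / ((k + m : ℕ) : ℝ) := by
      push_cast; field_simp; ring
    rw [e1, Real.log_div, Real.log_div, hεd]
    · push_cast
      field_simp
      ring
    all_goals positivity
  all_goals positivity

/-! ### Upper bounds for clique probabilities -/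

/-- The function `F_s(p)`: for each `p`, the probability that `s` random `⌊αd⌋`-dimensional subcubes
form a clique is at most `exp (-s d F_s(p))`, up to `exp (o(d))`. -/
noncomputable def cliqueRate (s : ℕ) (α p : ℝ) : ℝ := tClique s p + dimRate α p

theorem TClique_eq (s : ℕ) (α : ℝ) : TClique s α = cliqueRate s α (alphaInv s α) := by
  unfold TClique cliqueRate dimRate
  ring

theorem exp_tClique {p : ℝ} (h0 : 0 < p) (h1 : p < 1) {s : ℕ} (hs : 1 ≤ s) :
    Real.exp (-(s * tClique s p)) = compatProb s p := by
  have hs' : (0 : ℝ) < s := by exact_mod_cast hs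
  rw [← Real.exp_log (compatProb_pos h0 h1 s)]
  unfold tClique compatProb
  congr 1
  field_simp

theorem pairCompatProb_le_exp {p : ℝ} (h0 : 0 < p) (h1 : p < 1) {s j : ℕ} (hs : 1 ≤ s)
    (hj : j ≤ s) :
    pairCompatProb s j p ≤ Real.exp (-(((2 * s - j : ℕ) : ℝ) * tClique s p)) := by
  obtain ⟨hpos, hle⟩ := pairCompatProb_pow_le h0 h1 hj
  refine le_of_pow_le_pow_left₀ (n := s) (by omega) (Real.exp_pos _).le (hle.trans (le_of_eq ?_))
  rw [← exp_tClique h0 h1 hs, ← Real.exp_nat_mul, ← Real.exp_nat_mul]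
  congr 1
  ring

open Classical in
theorem pair_real_le {ι : Type*} [Fintype ι] {d k : ℕ} (hk : k ≤ d) {A B : Finset ι}
    (hAB : A ∪ B = Finset.univ) {s j : ℕ} (hs : 1 ≤ s) (hA : A.card = s) (hB : B.card = s)
    (hj : (A ∩ B).card = j) {p c : ℝ} (h0 : 0 < p) (h1 : p < 1)
    (hb : Real.exp (d * c) ≤ dimProb d k p) :
    (uniformModel ι d k).real
        {g | ∀ i, Compatible A (fun v => g v i) ∧ Compatible B (fun v => g v i)}
      ≤ Real.exp (-(((2 * s - j : ℕ) : ℝ) * (d * (tClique s p + c)))) := by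
  have hjs : j ≤ s := by rw [← hj, ← hA]; exact Finset.card_le_card Finset.inter_subset_left
  have hcard : Fintype.card ι = 2 * s - j := by
    have := Finset.card_union_add_card_inter A B
    rw [hAB, Finset.card_univ] at this
    omega
  refine (uniformModel_real_le hk (fun τ => Compatible A τ ∧ Compatible B τ) h0 h1).trans ?_
  have hsum := sum_compatible_pair hAB hA hB hj p
  rw [hcard]
  have hpos := (pairCompatProb_pow_le h0 h1 hjs).1
  calc _ = pairCompatProb s j p ^ d / dimProb d k p ^ (2 * s - j) := by
        rw [← hsum]
        congr!
    _ ≤ Real.exp (-(((2 * s - j : ℕ) : ℝ) * tClique s p)) ^ d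
        / Real.exp (d * c) ^ (2 * s - j) := by
        gcongr
        exact pairCompatProb_le_exp h0 h1 hs hjs
    _ = _ := by
        rw [← Real.exp_nat_mul, ← Real.exp_nat_mul, ← Real.exp_sub]
        congr 1
        ring

/-! ### Lower bounds for clique probabilities -/

theorem prod_ite_eq_mul_pow {ι : Type*} [Fintype ι] [DecidableEq ι] (v₀ : ι) (x y : ℝ) :
    ∏ v, (if v = v₀ then x else y) = x * y ^ (Fintype.card ι - 1) := by
  rw [Fintype.prod_eq_mul_prod_compl v₀, if_pos rfl]
  congr 1
  rw [Finset.prod_congr rfl (g := fun _ => y), Finset.prod_const, Finset.card_compl,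
    Finset.card_singleton]
  intro v hv
  rw [if_neg (by simpa using hv)]

open Classical in
/-- Chernoff bound: given that `s` subcubes of the binomial model form a clique, the dimension of
one of them has mean `d · α_s(p)`. -/
theorem sum_clique_tail_le {ι : Type*} [Fintype ι] {d : ℕ} {p : ℝ} (h0 : 0 < p) (h1 : p < 1)
    (v₀ : ι) {h : ℝ} (hh : |h| ≤ 1) (θ : ℝ) :
    ∑ g : ι → Subcube d, (if (∀ i, Compatible Finset.univ fun v => g v i) ∧
        h * (θ * d) ≤ h * (g v₀).dim then (1 : ℝ) else 0) * ∏ v, ∏ i, symbolWeight p (g v i)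
      ≤ compatProb (Fintype.card ι) p ^ d
        * Real.exp (d * (alphaFun (Fintype.card ι) p * h + h ^ 2 - h * θ)) := by
  set s := Fintype.card ι with hs
  have hs1 : 1 ≤ s := Fintype.card_pos_iff.2 ⟨v₀⟩
  set W : ι → Option Bool → ℝ := fun v o =>
    symbolWeight p o * if v = v₀ then (if o.isNone then Real.exp h else 1) else 1 with hW
  have hsw : ∀ o, 0 ≤ symbolWeight p o := by
    intro o; cases o <;> simp only [symbolWeight] <;> linarith
  have step : ∀ g : ι → Subcube d, (if (∀ i, Compatible Finset.univ fun v => g v i) ∧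
        h * (θ * d) ≤ h * (g v₀).dim then (1 : ℝ) else 0) * ∏ v, ∏ i, symbolWeight p (g v i)
      ≤ Real.exp (-(h * (θ * d))) * ((if (∀ i, Compatible Finset.univ fun v => g v i) then
        (1 : ℝ) else 0) * ∏ v, ∏ i, W v (g v i)) := by
    intro g
    have e1 : ∏ v, ∏ i, W v (g v i)
        = (∏ v, ∏ i, symbolWeight p (g v i)) * Real.exp (h * (g v₀).dim) := by
      simp only [hW, Finset.prod_mul_distrib]
      congr 1
      have : ∀ v, (∏ i, if v = v₀ then (if (g v i).isNone then Real.exp h else 1) else 1)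
          = if v = v₀ then Real.exp (h * (g v₀).dim) else 1 := by
        intro v
        by_cases hv : v = v₀
        · subst hv
          simp only [if_true]
          rw [Subcube.prod_symbol, one_pow, mul_one, ← Real.exp_nat_mul, mul_comm]
        · simp [hv]
      rw [Finset.prod_congr rfl fun v _ => this v, prod_ite_eq_mul_pow, one_pow, mul_one]
    have hP : 0 ≤ ∏ v, ∏ i, symbolWeight p (g v i) :=
      Finset.prod_nonneg fun v _ => Finset.prod_nonneg fun i _ => hsw _
    rw [e1]
    by_cases hc : ∀ i, Compatible Finset.univ fun v => g v i
    · by_cases hd : h * (θ * d) ≤ h * (g v₀).dim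
      · rw [if_pos ⟨hc, hd⟩, if_pos hc, one_mul, one_mul, mul_left_comm, ← Real.exp_add]
        exact le_mul_of_one_le_right hP (Real.one_le_exp (by linarith))
      · rw [if_neg (by tauto), zero_mul, if_pos hc]
        positivity
    · rw [if_neg (by tauto), if_neg hc]
      simp
  refine (Finset.sum_le_sum fun g _ => step g).trans ?_
  rw [← Finset.mul_sum, sum_coordwise (Compatible Finset.univ) W, sum_compatible_univ]
  have hq := compatProb_pos h0 h1 s
  have ha : p * (2 * ((1 + p) / 2) ^ (s - 1) - p ^ (s - 1))
      = alphaFun s p * compatProb s p := by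
    unfold alphaFun
    exact (div_mul_cancel₀ _ hq.ne').symm
  have hWsum : ∀ b : Bool, ∏ v, (W v none + W v (some b))
      = (p * Real.exp h + (1 - p) / 2) * ((1 + p) / 2) ^ (s - 1) := by
    intro b
    rw [← prod_ite_eq_mul_pow v₀]
    refine Finset.prod_congr rfl fun v _ => ?_
    by_cases hv : v = v₀ <;> simp [hW, hv, symbolWeight]
    ring
  have hWnone : ∏ v, W v none = p * Real.exp h * p ^ (s - 1) := by
    rw [← prod_ite_eq_mul_pow v₀]
    refine Finset.prod_congr rfl fun v _ => ?_
    by_cases hv : v = v₀ <;> simp [hW, hv, symbolWeight]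
  rw [hWsum, hWsum, hWnone]
  have htot : (p * Real.exp h + (1 - p) / 2) * ((1 + p) / 2) ^ (s - 1)
      + (p * Real.exp h + (1 - p) / 2) * ((1 + p) / 2) ^ (s - 1) - p * Real.exp h * p ^ (s - 1)
      = compatProb s p * (1 + alphaFun s p * (Real.exp h - 1)) := by
    have e : compatProb s p * (1 + alphaFun s p * (Real.exp h - 1))
      = compatProb s p + alphaFun s p * compatProb s p * (Real.exp h - 1) := by ring
    rw [e, ← ha]
    unfold compatProb
    obtain ⟨m, hm⟩ : ∃ m, s = m + 1 := ⟨s - 1, by omega⟩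
    rw [hm, Nat.add_sub_cancel, pow_succ, pow_succ p]
    ring
  rw [htot]
  have hα := (bijOn_alphaFun hs1).mapsTo ⟨h0, h1⟩
  have hle : 1 + alphaFun s p * (Real.exp h - 1) ≤ Real.exp (alphaFun s p * h + h ^ 2) := by
    have h2 := (abs_le.1 (Real.abs_exp_sub_one_sub_id_le hh)).2
    have h3 := mul_le_mul_of_nonneg_left h2 hα.1.le
    have h4 := mul_le_mul_of_nonneg_right hα.2.le (sq_nonneg h)
    have h5 := Real.add_one_le_exp (alphaFun s p * h + h ^ 2)
    linarith
  have hpos : 0 ≤ 1 + alphaFun s p * (Real.exp h - 1) := by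
    have := mul_pos hα.1 (Real.exp_pos h)
    linarith [hα.2]
  rw [mul_pow, mul_left_comm]
  refine mul_le_mul_of_nonneg_left ?_ (by positivity)
  calc _ ≤ Real.exp (-(h * (θ * d))) * Real.exp (alphaFun s p * h + h ^ 2) ^ d := by gcongr
    _ = _ := by
      rw [← Real.exp_nat_mul, ← Real.exp_add]
      congr 1
      ring

/-- The subcube `c'` arises from `c` by freeing coordinates. -/
def Subcube.Extends {d : ℕ} (c' c : Subcube d) : Prop := ∀ i, c' i = none ∨ c' i = c i

theorem Subcube.exists_extends {d k : ℕ} (hk : k ≤ d) (c : Subcube d) (hc : c.dim ≤ k) :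
    ∃ c' : Subcube d, c'.dim = k ∧ c'.Extends c := by
  classical
  obtain ⟨t, ht, -, htk⟩ := Finset.exists_subsuperset_card_eq
    (Finset.subset_univ (Finset.univ.filter fun i : Fin d => (c i).isNone)) hc (by simpa using hk)
  refine ⟨fun i => if i ∈ t then none else c i, ?_, fun i => ?_⟩
  · rw [← htk]
    refine congrArg Finset.card ?_
    ext i
    by_cases hi : i ∈ t
    · simp [hi]
    · have : c i ≠ none := fun h => hi (ht (by simp [h]))
      simp [hi, this]
  · by_cases hi : i ∈ t <;> simp [hi]

theorem Compatible.of_extends {ι : Type*} {d : ℕ} {g g' : ι → Subcube d} {A : Finset ι}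
    (h : ∀ v, (g' v).Extends (g v)) {i : Fin d} (hg : Compatible A fun v => g v i) :
    Compatible A fun v => g' v i := by
  intro u hu v hv hut hvf
  have h1 : g u i = some true := by
    rcases h u i with h | h <;> simp_all
  have h2 : g v i = some false := by
    rcases h v i with h | h <;> simp_all
  exact hg u hu v hv h1 h2

/-- Symbol kernel from a coordinate of a subcube to a coordinate of an extension; the weight
`exp (-L)` is paid when the coordinate is freed. -/
noncomputable def freeKernel (L : ℝ) (o o' : Option Bool) : ℝ :=
  if o' = none then (if o = none then 1 else Real.exp (-L)) else if o = o' then 1 else 0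

theorem freeKernel_nonneg (L : ℝ) (o o' : Option Bool) : 0 ≤ freeKernel L o o' := by
  unfold freeKernel
  split_ifs <;> positivity

/-- The product of the symbol kernels is `exp (-L)` to the number of freed coordinates. -/
theorem one_le_prod_freeKernel {d : ℕ} {L m : ℝ} (hL : 0 ≤ L) {c c' : Subcube d}
    (h : c'.Extends c) (hm : (c'.dim : ℝ) - c.dim ≤ m) :
    1 ≤ Real.exp (L * m) * ∏ i, freeKernel L (c i) (c' i) := by
  have e1 : (∏ i, freeKernel L (c i) (c' i)) * Real.exp (-(L * c.dim))
      = Real.exp (-(L * c'.dim)) := by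
    have h1 := Subcube.prod_symbol c (Real.exp (-L)) 1
    have h2 := Subcube.prod_symbol c' (Real.exp (-L)) 1
    rw [one_pow, mul_one, ← Real.exp_nat_mul] at h1 h2
    rw [show -(L * (c.dim : ℝ)) = c.dim * -L by ring,
      show -(L * (c'.dim : ℝ)) = c'.dim * -L by ring, ← h1, ← h2, ← Finset.prod_mul_distrib]
    refine Finset.prod_congr rfl fun i _ => ?_
    unfold freeKernel
    rcases h i with h | h
    · cases hc : c i <;> simp [h]
    · cases hc : c i <;> simp [h, hc]
  have e2 : (∏ i, freeKernel L (c i) (c' i)) = Real.exp (-(L * c'.dim) + L * c.dim) := by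
    rw [Real.exp_add, ← e1, mul_assoc, ← Real.exp_add]
    simp
  rw [e2, ← Real.exp_add]
  refine Real.one_le_exp ?_
  have := mul_le_mul_of_nonneg_left hm hL
  linarith

/-- The binomial weight of the subcubes that a given subcube extends, discounted by `exp (-L)` for
each freed coordinate. -/
theorem sum_freeKernel_le {d : ℕ} {L p : ℝ} (h0 : 0 < p) (h1 : p < 1) (c' : Subcube d) :
    ∑ c : Subcube d, ∏ i, (symbolWeight p (c i) * freeKernel L (c i) (c' i))
      ≤ p ^ c'.dim * ((1 - p) / 2) ^ (d - c'.dim) * Real.exp (d * (Real.exp (-L) / p)) := by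
  classical
  have h2 := sum_prod_eq_prod_sum (κ := Fin d) (fun i o => symbolWeight p o * freeKernel L o (c' i))
  have h3 : ∀ i, ∑ o, symbolWeight p o * freeKernel L o (c' i)
      = if (c' i).isNone then p + (1 - p) * Real.exp (-L) else (1 - p) / 2 := by
    intro i
    cases hc : c' i with
    | none => simp [Fintype.sum_option, freeKernel, symbolWeight]; ring
    | some b => cases b <;> simp [freeKernel, symbolWeight]
  have h4 : ∑ c : Subcube d, ∏ i, (symbolWeight p (c i) * freeKernel L (c i) (c' i))
      = (p + (1 - p) * Real.exp (-L)) ^ c'.dim * ((1 - p) / 2) ^ (d - c'.dim) := by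
    rw [← Subcube.prod_symbol, ← Finset.prod_congr rfl fun i _ => h3 i]
    exact h2
  rw [h4, mul_right_comm]
  have hr : 0 ≤ (1 - p) / 2 := by linarith
  refine mul_le_mul_of_nonneg_right ?_ (by positivity)
  have h5 : p + (1 - p) * Real.exp (-L) ≤ p * Real.exp (Real.exp (-L) / p) := by
    have h6 := Real.add_one_le_exp (Real.exp (-L) / p)
    have h7 := mul_le_mul_of_nonneg_left h6 h0.le
    have h8 : p * (Real.exp (-L) / p + 1) = Real.exp (-L) + p := by field_simp
    have h9 : 0 < p * Real.exp (-L) := by positivity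
    linarith
  have h6 : 0 ≤ p + (1 - p) * Real.exp (-L) := by
    have := mul_nonneg (show 0 ≤ 1 - p by linarith) (Real.exp_pos (-L)).le
    linarith
  calc _ ≤ (p * Real.exp (Real.exp (-L) / p)) ^ c'.dim := pow_le_pow_left₀ h6 h5 _
    _ = p ^ c'.dim * Real.exp (c'.dim * (Real.exp (-L) / p)) := by
      rw [mul_pow, ← Real.exp_nat_mul]
    _ ≤ _ := by
      have := c'.dim_le
      gcongr

open Classical in
/-- Cliques of subcubes whose dimensions lie slightly below `k` are turned into cliques of
`k`-dimensional subcubes by freeing few coordinates, at a small cost. -/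
theorem sum_near_le {ι : Type*} [Fintype ι] {d k : ℕ} (hk : k ≤ d) {p L m : ℝ} (h0 : 0 < p)
    (h1 : p < 1) (hL : 0 ≤ L) :
    ∑ g : ι → Subcube d, (if (∀ i, Compatible Finset.univ fun v => g v i) ∧
        ∀ v, (g v).dim ≤ k ∧ (k : ℝ) - (g v).dim ≤ m then (1 : ℝ) else 0)
        * ∏ v, ∏ i, symbolWeight p (g v i)
      ≤ (uniformModel ι d k).real {g | ∀ i, Compatible Finset.univ fun v => g v i}
        * (dimProb d k p * Real.exp (L * m + d * (Real.exp (-L) / p))) ^ Fintype.card ι := by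
  have hsw : ∀ o, 0 ≤ symbolWeight p o := by
    intro o; cases o <;> simp only [symbolWeight] <;> linarith
  have hn : (0 : ℝ) < numSubcubes d k := by exact_mod_cast numSubcubes_pos hk
  have hr : 0 ≤ (1 - p) / 2 := by linarith
  set I : (ι → Subcube d) → ℝ := fun g' => if (∀ i, Compatible Finset.univ fun v => g' v i) ∧
    ∀ v, (g' v).dim = k then 1 else 0 with hI
  have hI0 : ∀ g, 0 ≤ I g := fun g => by simp only [hI]; split_ifs <;> norm_num
  set w : Subcube d → Subcube d → ℝ := fun c c' =>
    Real.exp (L * m) * ∏ i, (symbolWeight p (c i) * freeKernel L (c i) (c' i)) with hw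
  have hw0 : ∀ c c', 0 ≤ w c c' := fun c c' => mul_nonneg (Real.exp_pos _).le
    (Finset.prod_nonneg fun i _ => mul_nonneg (hsw _) (freeKernel_nonneg _ _ _))
  have step : ∀ g : ι → Subcube d, (if (∀ i, Compatible Finset.univ fun v => g v i) ∧
        ∀ v, (g v).dim ≤ k ∧ (k : ℝ) - (g v).dim ≤ m then (1 : ℝ) else 0)
        * ∏ v, ∏ i, symbolWeight p (g v i) ≤ ∑ g', I g' * ∏ v, w (g v) (g' v) := by
    intro g
    have hnn : ∀ g' ∈ (Finset.univ : Finset (ι → Subcube d)), 0 ≤ I g' * ∏ v, w (g v) (g' v) :=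
      fun g' _ => mul_nonneg (hI0 g') (Finset.prod_nonneg fun v _ => hw0 _ _)
    by_cases hg : (∀ i, Compatible Finset.univ fun v => g v i) ∧
        ∀ v, (g v).dim ≤ k ∧ (k : ℝ) - (g v).dim ≤ m
    · rw [if_pos hg, one_mul]
      choose g' hg'k hg' using fun v => Subcube.exists_extends hk (g v) (hg.2 v).1
      refine le_trans ?_ (Finset.single_le_sum hnn (Finset.mem_univ g'))
      have hIg : I g' = 1 := by
        simp only [hI]
        rw [if_pos ⟨fun i => Compatible.of_extends hg' (hg.1 i), hg'k⟩]
      rw [hIg, one_mul]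
      refine Finset.prod_le_prod (fun v _ => Finset.prod_nonneg fun i _ => hsw _) fun v _ => ?_
      simp only [hw]
      rw [Finset.prod_mul_distrib, mul_left_comm]
      refine le_mul_of_one_le_right (Finset.prod_nonneg fun i _ => hsw _) ?_
      exact one_le_prod_freeKernel hL (hg' v) (by rw [hg'k]; exact (hg.2 v).2)
    · rw [if_neg hg, zero_mul]
      exact Finset.sum_nonneg hnn
  refine (Finset.sum_le_sum fun g _ => step g).trans ?_
  rw [Finset.sum_comm, uniformModel_real hk, Finset.sum_mul]
  refine Finset.sum_le_sum fun g' _ => ?_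
  rw [← Finset.mul_sum]
  by_cases hg' : (∀ i, Compatible Finset.univ fun v => g' v i) ∧ ∀ v, (g' v).dim = k
  swap
  · simp only [hI]
    rw [if_neg hg', zero_mul]
    have := dimProb_pos hk h0 h1
    refine mul_nonneg (mul_nonneg ?_ (Finset.prod_nonneg fun v _ => ?_)) (by positivity)
    · split_ifs <;> norm_num
    · split_ifs <;> positivity
  · have hIg : I g' = 1 := by
      simp only [hI]
      rw [if_pos hg']
    have hmem : g' ∈ {g : ι → Subcube d | ∀ i, Compatible Finset.univ fun v => g v i} := hg'.1
    rw [hIg, if_pos hmem, one_mul, one_mul]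
    have hsum := sum_prod_eq_prod_sum (κ := ι) (fun v c => w c (g' v))
    rw [hsum, ← Finset.card_univ, ← Finset.prod_const, ← Finset.prod_mul_distrib]
    refine Finset.prod_le_prod (fun v _ => Finset.sum_nonneg fun c _ => hw0 _ _) fun v _ => ?_
    rw [if_pos (hg'.2 v)]
    simp only [hw]
    rw [← Finset.mul_sum]
    have h5 := sum_freeKernel_le (L := L) h0 h1 (g' v)
    rw [hg'.2 v] at h5
    refine (mul_le_mul_of_nonneg_left h5 (Real.exp_pos _).le).trans (le_of_eq ?_)
    rw [dimProb_eq, Real.exp_add]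
    field_simp

/-- The clique probability for an arbitrary binomial parameter `p` below `α_s⁻¹(α)`: with
`δ = α - α_s(p)`, the dimensions of binomial subcubes forming a clique lie between `k - 2δd` and `k`,
up to two Chernoff tails for each of the subcubes. The parameter `L` is the cost of a freed
coordinate. -/
theorem clique_real_ge_of_params {ι : Type*} [Fintype ι] {α p L : ℝ} (hα0 : 0 < α) (hα1 : α < 1)
    (h0 : 0 < p) (h1 : p < 1) (hL : 0 ≤ L) (hι : 1 ≤ Fintype.card ι)
    (hδ : alphaFun (Fintype.card ι) p < α) (d : ℕ) :
    compatProb (Fintype.card ι) p ^ d * (1 - 2 * Fintype.card ι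
        * Real.exp (-(d * ((α - alphaFun (Fintype.card ι) p) ^ 2 / 4))))
      ≤ (uniformModel ι d ⌊α * (d : ℝ)⌋₊).real {g | ∀ i, Compatible Finset.univ fun v => g v i}
        * (dimProb d ⌊α * (d : ℝ)⌋₊ p * Real.exp (L * (2 * (α - alphaFun (Fintype.card ι) p) * d)
          + d * (Real.exp (-L) / p))) ^ Fintype.card ι := by
  classical
  have hk := floor_le hα0 hα1 d
  have hkα : (⌊α * (d : ℝ)⌋₊ : ℝ) ≤ α * d := Nat.floor_le (by positivity)
  have hkα' : α * d < (⌊α * (d : ℝ)⌋₊ : ℝ) + 1 := Nat.lt_floor_add_one _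
  set k := ⌊α * (d : ℝ)⌋₊ with hkd
  set s := Fintype.card ι with hs
  set a := alphaFun s p with ha
  have hamem := (bijOn_alphaFun hι).mapsTo ⟨h0, h1⟩
  set δ := α - a with hδd
  have hδ0 : 0 < δ := by linarith
  have hδ1 : δ ≤ 1 := by linarith [hamem.1]
  refine le_trans ?_ (sum_near_le (m := 2 * δ * d) hk h0 h1 hL)
  have hsw : ∀ o, 0 ≤ symbolWeight p o := by
    intro o; cases o <;> simp only [symbolWeight] <;> linarith
  have hfull := sum_coordwise (d := d) (Compatible (Finset.univ : Finset ι))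
    (fun _ => symbolWeight p)
  rw [sum_compatible_univ] at hfull
  have hq : (∏ _v : ι, (symbolWeight p none + symbolWeight p (some false))
      + ∏ _v : ι, (symbolWeight p none + symbolWeight p (some true)) - ∏ _v : ι, symbolWeight p none)
      = compatProb s p := by
    have hu : p + (1 - p) / 2 = (1 + p) / 2 := by ring
    simp only [symbolWeight, Finset.prod_const, Finset.card_univ, hu, compatProb]
    ring
  rw [hq] at hfull
  -- The exponents `±δ/2` minimise the Chernoff bounds for the deviations `±δd` from the mean.
  have hup : ∀ v : ι, _ := fun v => sum_clique_tail_le (d := d) h0 h1 v (h := δ / 2)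
    (by rw [abs_of_pos (by linarith)]; linarith) (a + δ)
  have hlo : ∀ v : ι, _ := fun v => sum_clique_tail_le (d := d) h0 h1 v (h := -(δ / 2))
    (by rw [abs_neg, abs_of_pos (by linarith)]; linarith) (a - δ)
  have e1 : (d : ℝ) * (alphaFun (Fintype.card ι) p * (δ / 2) + (δ / 2) ^ 2 - δ / 2 * (a + δ))
      = -(d * (δ ^ 2 / 4)) := by rw [← hs, ← ha]; ring
  have e2 : (d : ℝ) * (alphaFun (Fintype.card ι) p * (-(δ / 2)) + (-(δ / 2)) ^ 2
      - -(δ / 2) * (a - δ)) = -(d * (δ ^ 2 / 4)) := by rw [← hs, ← ha]; ring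
  simp only [e1] at hup
  simp only [e2] at hlo
  have hsumup := Finset.sum_le_sum fun v (_ : v ∈ (Finset.univ : Finset ι)) =>
    add_le_add (hup v) (hlo v)
  rw [Finset.sum_const, Finset.card_univ, nsmul_eq_mul, ← hs] at hsumup
  have e3 : compatProb s p ^ d * (1 - 2 * s * Real.exp (-(d * (δ ^ 2 / 4))))
      = compatProb s p ^ d - s * (compatProb s p ^ d * Real.exp (-(d * (δ ^ 2 / 4)))
        + compatProb s p ^ d * Real.exp (-(d * (δ ^ 2 / 4)))) := by ring
  rw [e3, sub_le_iff_le_add]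
  refine le_trans ?_ (add_le_add_right hsumup _)
  rw [← hfull]
  simp only [← Finset.sum_add_distrib]
  rw [Finset.sum_comm, ← Finset.sum_add_distrib]
  refine Finset.sum_le_sum fun g _ => ?_
  have hP : 0 ≤ ∏ v, ∏ i, symbolWeight p (g v i) :=
    Finset.prod_nonneg fun v _ => Finset.prod_nonneg fun i _ => hsw _
  simp only [← add_mul, ← Finset.sum_mul]
  refine mul_le_mul_of_nonneg_right ?_ hP
  have hnn : ∀ v ∈ (Finset.univ : Finset ι), (0 : ℝ) ≤
      (if (∀ i, Compatible Finset.univ fun v => g v i) ∧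
        δ / 2 * ((a + δ) * d) ≤ δ / 2 * (g v).dim then (1 : ℝ) else 0) +
      (if (∀ i, Compatible Finset.univ fun v => g v i) ∧
        -(δ / 2) * ((a - δ) * d) ≤ -(δ / 2) * (g v).dim then (1 : ℝ) else 0) := by
    intro v _
    split_ifs <;> norm_num
  by_cases hc : ∀ i, Compatible Finset.univ fun v => g v i
  swap
  · rw [if_neg hc]
    have := Finset.sum_nonneg hnn
    split_ifs <;> linarith
  rw [if_pos hc]
  by_cases hgood : ∀ v, (g v).dim ≤ k ∧ (k : ℝ) - (g v).dim ≤ 2 * δ * d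
  · rw [if_pos ⟨hc, hgood⟩]
    have := Finset.sum_nonneg hnn
    linarith
  · rw [if_neg (by tauto), zero_add]
    rw [not_forall] at hgood
    obtain ⟨v, hv⟩ := hgood
    refine le_trans ?_ (Finset.single_le_sum hnn (Finset.mem_univ v))
    have hd : a + δ = α := by ring
    by_cases hvk : (g v).dim ≤ k
    · have hlow : ¬ ((k : ℝ) - (g v).dim ≤ 2 * δ * d) := fun h => hv ⟨hvk, h⟩
      have : -(δ / 2) * ((a - δ) * d) ≤ -(δ / 2) * (g v).dim := by
        refine mul_le_mul_of_nonpos_left ?_ (by linarith)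
        have : (a - δ) * d = α * d - 2 * δ * d := by rw [← hd]; ring
        linarith
      rw [if_pos (⟨hc, this⟩ : _ ∧ _)]
      split_ifs <;> norm_num
    · have hvk' : (k : ℝ) + 1 ≤ (g v).dim := by exact_mod_cast not_le.1 hvk
      have : δ / 2 * ((a + δ) * d) ≤ δ / 2 * (g v).dim := by
        refine mul_le_mul_of_nonneg_left ?_ (by linarith)
        rw [hd]; linarith
      rw [if_pos (⟨hc, this⟩ : _ ∧ _)]
      split_ifs <;> norm_num

/-! ### Exponential rates of clique probabilities and monotonicity of the thresholds -/

theorem alphaInv_mem {s : ℕ} (hs : 1 ≤ s) {α : ℝ} (hα0 : 0 < α) (hα1 : α < 1) :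
    alphaInv s α ∈ Set.Ioo (0 : ℝ) 1 ∧ alphaFun s (alphaInv s α) = α := by
  have h := (bijOn_alphaFun hs).surjOn ⟨hα0, hα1⟩
  exact ⟨Function.invFunOn_mem h, Function.invFunOn_eq h⟩

theorem continuousAt_cliqueRate {s : ℕ} {α p : ℝ} (hα0 : 0 < α) (hα1 : α < 1) (h0 : 0 < p)
    (h1 : p < 1) : ContinuousAt (cliqueRate s α) p := by
  have hq := alphaFun_denom_pos s h0.le h1.le
  have h2 : p / α ≠ 0 := by positivity
  have h3 : (1 - p) / (1 - α) ≠ 0 := (div_pos (by linarith) (by linarith)).ne'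
  unfold cliqueRate tClique dimRate
  fun_prop (disch := first | exact hq.ne' | assumption)

theorem continuousAt_alphaFun {s : ℕ} {p : ℝ} (h0 : 0 < p) (h1 : p < 1) :
    ContinuousAt (alphaFun s) p := by
  have hq := alphaFun_denom_pos s h0.le h1.le
  unfold alphaFun
  fun_prop (disch := exact hq.ne')

universe u

theorem eventually_clique_real_ge {α : ℝ} (hα0 : 0 < α) (hα1 : α < 1) {s : ℕ} (hs : 1 ≤ s)
    {η : ℝ} (hη : 0 < η) :
    ∀ᶠ d : ℕ in atTop, ∀ (ι : Type u) [Fintype ι], Fintype.card ι = s →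
      Real.exp (-(s * (d * (TClique s α + η))))
        ≤ (uniformModel ι d ⌊α * (d : ℝ)⌋₊).real
          {g | ∀ i, Compatible Finset.univ fun v => g v i} := by
  obtain ⟨⟨hp0, hp1⟩, hpα⟩ := alphaInv_mem hs hα0 hα1
  rw [TClique_eq]
  set p₀ := alphaInv s α
  obtain ⟨L, hL0, hL⟩ : ∃ L : ℝ, 0 ≤ L ∧ Real.exp (-L) / p₀ < η / 2 := by
    have h : Tendsto (fun L : ℝ => Real.exp (-L) / p₀) atTop (𝓝 0) := by
      simpa using (Real.tendsto_exp_neg_atTop_nhds_zero).div_const p₀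
    exact ((eventually_ge_atTop 0).and (h.eventually_lt_const (by positivity))).exists
  -- First the cost `L` is fixed, then `p` is taken so close to `p₀` that few coordinates are freed.
  have hcont : ContinuousAt (fun p => cliqueRate s α p + (L * (2 * (α - alphaFun s p))
      + Real.exp (-L) / p)) p₀ := by
    have h1 := continuousAt_cliqueRate (s := s) hα0 hα1 hp0 hp1
    have h2 := continuousAt_alphaFun (s := s) hp0 hp1
    have h3 : ContinuousAt (fun p : ℝ => Real.exp (-L) / p) p₀ :=
      continuousAt_const.div continuousAt_id hp0.ne'
    fun_prop
  have hlt : cliqueRate s α p₀ + (L * (2 * (α - alphaFun s p₀)) + Real.exp (-L) / p₀)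
      < cliqueRate s α p₀ + η / 2 := by
    rw [hpα]; simpa using hL
  obtain ⟨p, ⟨hp, hpp⟩, hpos⟩ := (((hcont.eventually_lt_const hlt).filter_mono
    nhdsWithin_le_nhds).and (self_mem_nhdsWithin (s := Set.Iio p₀))).and
      ((lt_mem_nhds hp0).filter_mono nhdsWithin_le_nhds) |>.exists
  have hplt : p < p₀ := hpp
  have hp1' : p < 1 := hplt.trans hp1
  have hδ : alphaFun s p < α := by
    rw [← hpα]
    exact strictMonoOn_alphaFun hs ⟨hpos.le, hp1'.le⟩ ⟨hp0.le, hp1.le⟩ hplt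
  have hs' : (0 : ℝ) < s := by exact_mod_cast hs
  have ev1 : ∀ᶠ d : ℕ in atTop,
      2 * s * Real.exp (-(d * ((α - alphaFun s p) ^ 2 / 4))) ≤ 1 / 2 := by
    have h : Tendsto (fun d : ℕ => 2 * s * Real.exp (-((d : ℝ) * ((α - alphaFun s p) ^ 2 / 4))))
        atTop (𝓝 (2 * s * 0)) := by
      refine Tendsto.const_mul _ (Real.tendsto_exp_neg_atTop_nhds_zero.comp ?_)
      refine tendsto_natCast_atTop_atTop.atTop_mul_const ?_
      have : 0 < α - alphaFun s p := by linarith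
      positivity
    rw [mul_zero] at h
    exact (h.eventually_lt_const (by norm_num)).mono fun d hd => hd.le
  have ev2 : ∀ᶠ d : ℕ in atTop, Real.exp (-(s * (d * (η / 4)))) ≤ 1 / 2 := by
    have h : Tendsto (fun d : ℕ => Real.exp (-(s * ((d : ℝ) * (η / 4))))) atTop (𝓝 0) :=
      Real.tendsto_exp_neg_atTop_nhds_zero.comp
        ((tendsto_natCast_atTop_atTop.atTop_mul_const (by positivity)).const_mul_atTop hs')
    exact (h.eventually_lt_const (by norm_num)).mono fun d hd => hd.le
  have ev3 := (tendsto_log_dimProb hα0 hα1 hpos hp1').eventually_lt_const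
    (show dimRate α p < dimRate α p + η / 4 by linarith)
  filter_upwards [ev1, ev2, ev3, eventually_gt_atTop 0] with d h1 h2 h3 hd ι _ hι
  subst hι
  have hmain := clique_real_ge_of_params (ι := ι) (L := L) hα0 hα1 hpos hp1' hL0 hs hδ d
  set s := Fintype.card ι
  set π := (uniformModel ι d ⌊α * (d : ℝ)⌋₊).real {g | ∀ i, Compatible Finset.univ fun v => g v i}
  have hd' : (0 : ℝ) < d := by exact_mod_cast hd
  have hdim : dimProb d ⌊α * (d : ℝ)⌋₊ p ≤ Real.exp (d * (dimRate α p + η / 4)) := by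
    rw [div_lt_iff₀ hd'] at h3
    rw [← Real.log_le_iff_le_exp (dimProb_pos (floor_le hα0 hα1 d) hpos hp1')]
    linarith
  have hdim0 := dimProb_pos (floor_le hα0 hα1 d) hpos hp1'
  have hπ0 : 0 ≤ π := measureReal_nonneg
  have hq : compatProb s p ^ d = Real.exp (-(s * (d * tClique s p))) := by
    rw [← exp_tClique hpos hp1' hs, ← Real.exp_nat_mul]
    congr 1; ring
  have hA : Real.exp (-(s * (d * tClique s p))) * Real.exp (-(s * (d * (η / 4))))
      ≤ π * Real.exp (s * (d * (dimRate α p + η / 4 + (L * (2 * (α - alphaFun s p))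
      + Real.exp (-L) / p)))) := by
    calc _ ≤ compatProb s p ^ d * (1 - 2 * s
        * Real.exp (-(d * ((α - alphaFun s p) ^ 2 / 4)))) := by
          rw [hq]; gcongr; linarith
      _ ≤ _ := hmain
      _ ≤ π * (Real.exp (d * (dimRate α p + η / 4)) * Real.exp (L * (2 * (α - alphaFun s p) * d)
          + d * (Real.exp (-L) / p))) ^ s := by gcongr
      _ = _ := by
          rw [← Real.exp_add, ← Real.exp_nat_mul]
          congr 2; ring
  rw [← Real.exp_add, ← div_le_iff₀ (Real.exp_pos _), ← Real.exp_sub] at hA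
  refine le_trans (Real.exp_le_exp.2 ?_) hA
  have hp' : cliqueRate s α p + (L * (2 * (α - alphaFun s p)) + Real.exp (-L) / p)
      ≤ cliqueRate s α p₀ + η / 2 := hp.le
  have h5 := mul_le_mul_of_nonneg_left hp' (by positivity : (0 : ℝ) ≤ s * d)
  have h6 : cliqueRate s α p = tClique s p + dimRate α p := rfl
  rw [h6] at h5
  linarith

open Classical in
theorem eventually_pair_real_le {α p : ℝ} (hα0 : 0 < α) (hα1 : α < 1) (h0 : 0 < p) (h1 : p < 1)
    {s : ℕ} (hs : 1 ≤ s) {η : ℝ} (hη : 0 < η) :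
    ∀ᶠ d : ℕ in atTop, ∀ (ι : Type u) [Fintype ι] (A B : Finset ι) (j : ℕ), A ∪ B = Finset.univ →
      A.card = s → B.card = s → (A ∩ B).card = j →
      (uniformModel ι d ⌊α * (d : ℝ)⌋₊).real
          {g | ∀ i, Compatible A (fun v => g v i) ∧ Compatible B (fun v => g v i)}
        ≤ Real.exp (-(((2 * s - j : ℕ) : ℝ) * (d * (cliqueRate s α p - η)))) := by
  have ev := (tendsto_log_dimProb hα0 hα1 h0 h1).eventually_const_lt
    (show dimRate α p - η < dimRate α p by linarith)
  filter_upwards [ev, eventually_gt_atTop 0] with d h2 hd ι _ A B j hAB hA hB hj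
  have hd' : (0 : ℝ) < d := by exact_mod_cast hd
  have hk := floor_le hα0 hα1 d
  have hb : Real.exp (d * (dimRate α p - η)) ≤ dimProb d ⌊α * (d : ℝ)⌋₊ p := by
    rw [lt_div_iff₀ hd'] at h2
    rw [← Real.le_log_iff_exp_le (dimProb_pos hk h0 h1)]
    linarith
  have h3 := pair_real_le hk hAB hs hA hB hj h0 h1 hb
  refine h3.trans (le_of_eq ?_)
  unfold cliqueRate
  congr 1; ring

theorem eventually_clique_real_le {α p : ℝ} (hα0 : 0 < α) (hα1 : α < 1) (h0 : 0 < p) (h1 : p < 1)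
    {s : ℕ} (hs : 1 ≤ s) {η : ℝ} (hη : 0 < η) :
    ∀ᶠ d : ℕ in atTop, ∀ (ι : Type u) [Fintype ι], Fintype.card ι = s →
      (uniformModel ι d ⌊α * (d : ℝ)⌋₊).real {g | ∀ i, Compatible Finset.univ fun v => g v i}
        ≤ Real.exp (-(s * (d * (cliqueRate s α p - η)))) := by
  classical
  filter_upwards [eventually_pair_real_le.{u} hα0 hα1 h0 h1 hs hη] with d h ι _ hι
  have h2 := h ι Finset.univ Finset.univ s (by simp) (by simpa using hι) (by simpa using hι)
    (by simpa using hι)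
  simp only [and_self] at h2
  rwa [show 2 * s - s = s by omega] at h2

/-- `T_{K_s}(α)` is the maximum of `cliqueRate s α` on `(0,1)`: both bounds on the probability of a
clique hold simultaneously. -/
theorem cliqueRate_le_TClique {α p : ℝ} (hα0 : 0 < α) (hα1 : α < 1) (h0 : 0 < p) (h1 : p < 1)
    {s : ℕ} (hs : 1 ≤ s) : cliqueRate s α p ≤ TClique s α := by
  refine le_of_forall_pos_le_add fun η hη => ?_
  obtain ⟨d, ⟨hlo, hup⟩, hd⟩ := (((eventually_clique_real_ge.{0} hα0 hα1 hs (half_pos hη)).and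
    (eventually_clique_real_le.{0} hα0 hα1 h0 h1 hs (half_pos hη))).and
      (eventually_gt_atTop 0)).exists
  have h := (hlo (Fin s) (by simp)).trans (hup (Fin s) (by simp))
  rw [Real.exp_le_exp] at h
  have hs' : (0 : ℝ) < s := by exact_mod_cast hs
  have hd' : (0 : ℝ) < d := by exact_mod_cast hd
  have h2 : s * (d * (cliqueRate s α p - η / 2)) ≤ s * (d * (TClique s α + η / 2)) := by linarith
  have h3 := le_of_mul_le_mul_left (le_of_mul_le_mul_left h2 hs') hd'
  linarith

theorem TClique_lt_succ {α : ℝ} (hα0 : 0 < α) (hα1 : α < 1) {s : ℕ} (hs : 1 ≤ s) :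
    TClique s α < TClique (s + 1) α := by
  obtain ⟨⟨hp0, hp1⟩, -⟩ := alphaInv_mem hs hα0 hα1
  refine lt_of_lt_of_le ?_ (cliqueRate_le_TClique hα0 hα1 hp0 hp1 (by omega : 1 ≤ s + 1))
  rw [TClique_eq]
  unfold cliqueRate
  have := tClique_lt_succ hp0 hp1 hs
  linarith

theorem TClique_nonneg {α : ℝ} (hα0 : 0 < α) (hα1 : α < 1) {s : ℕ} (hs : 1 ≤ s) :
    0 ≤ TClique s α := by
  induction s, hs using Nat.le_induction with
  | base =>
    refine le_trans ?_ (cliqueRate_le_TClique hα0 hα1 hα0 hα1 le_rfl)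
    have h : 2 * ((1 + α) / 2) - α = 1 := by ring
    simp [cliqueRate, dimRate, tClique, h, hα0.ne', (sub_pos.2 hα1).ne']
  | succ s hs ih => exact ih.trans (TClique_lt_succ hα0 hα1 hs).le

/-! ### First and second moments -/

/-- The event that the members of `A` form a clique. -/
def cliqueEvent {V : Type*} {d : ℕ} (A : Finset V) : Set (V → Subcube d) :=
  {f | ∀ i, Compatible A fun v => f v i}

theorem cliqueEvent_eq {V : Type*} {d : ℕ} {A U : Finset V} [DecidableEq V] (hAU : A ⊆ U) :
    (cliqueEvent A : Set (V → Subcube d)) = {f | (fun v : U => f v) ∈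
      (cliqueEvent (A.subtype (· ∈ U)) : Set (U → Subcube d))} := by
  ext f
  refine forall_congr' fun i => ⟨fun h u hu v hv => ?_, fun h u hu v hv => ?_⟩
  · exact h u (by simpa using hu) v (by simpa using hv)
  · exact h ⟨u, hAU hu⟩ (by simpa using hu) ⟨v, hAU hv⟩ (by simpa using hv)

theorem cliqueEvent_real {V : Type*} [Fintype V] {d k : ℕ} (hk : k ≤ d) (A : Finset V) :
    (uniformModel V d k).real (cliqueEvent A)
      = (uniformModel A d k).real {g | ∀ i, Compatible Finset.univ fun v => g v i} := by
  classical
  rw [cliqueEvent_eq (Finset.Subset.refl A), uniformModel_real_restrict hk]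
  congr 1
  unfold cliqueEvent
  rw [show A.subtype (· ∈ A) = Finset.univ by ext; simp]

open Classical in
theorem cliqueEvent_inter_real {V : Type*} [Fintype V] {d k : ℕ} (hk : k ≤ d) (A B : Finset V) :
    (uniformModel V d k).real (cliqueEvent A ∩ cliqueEvent B)
      = (uniformModel (A ∪ B : Finset V) d k).real
        {g | ∀ i, Compatible (A.subtype (· ∈ A ∪ B)) (fun v => g v i) ∧
          Compatible (B.subtype (· ∈ A ∪ B)) (fun v => g v i)} := by
  rw [← uniformModel_real_restrict hk, cliqueEvent_eq (Finset.subset_union_left (s₂ := B)),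
    cliqueEvent_eq (Finset.subset_union_right (s₁ := A))]
  congr 1
  ext f
  exact forall_and.symm

theorem cliqueEvent_inter_of_disjoint {V : Type*} [Fintype V] {d k : ℕ} (hk : k ≤ d)
    {A B : Finset V} (h : Disjoint A B) :
    (uniformModel V d k).real (cliqueEvent A ∩ cliqueEvent B)
      = (uniformModel V d k).real (cliqueEvent A) * (uniformModel V d k).real (cliqueEvent B) := by
  classical
  rw [cliqueEvent_eq (Finset.Subset.refl A), cliqueEvent_eq (Finset.Subset.refl B)]
  exact uniformModel_real_inter hk h _ _

open Classical in
/-- Second moment method for a sum of indicators, where `D` is a dependency relation. -/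
theorem second_moment {Ω κ : Type*} [MeasurableSpace Ω] [DiscreteMeasurableSpace Ω] [Finite Ω]
    (μ : Measure Ω) [IsProbabilityMeasure μ] (T : Finset κ) (E : κ → Set Ω) (D : κ → κ → Prop)
    (hD : ∀ a ∈ T, ∀ b ∈ T, ¬ D a b → μ.real (E a ∩ E b) = μ.real (E a) * μ.real (E b))
    {R m : ℝ} (hR : ∑ a ∈ T, ∑ b ∈ T with D a b, μ.real (E a ∩ E b) ≤ R)
    (hm : m = ∑ a ∈ T, μ.real (E a)) (hm0 : 0 < m) :
    μ.real {ω | 2 * ((T.filter fun a => ω ∈ E a).card : ℝ) ≤ m} ≤ 4 * R / m ^ 2 := by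
  set X : Ω → ℝ := fun ω => ∑ a ∈ T, (E a).indicator 1 ω with hX
  have hXcard : ∀ ω, X ω = (T.filter fun a => ω ∈ E a).card := by
    intro ω
    simp [hX, Set.indicator_apply]
  have hint : ∀ f : Ω → ℝ, Integrable f μ := fun f => MemLp.of_discrete.integrable le_top
  have hEX : ∫ ω, X ω ∂μ = m := by
    rw [hm, hX, integral_finsetSum _ fun a _ => hint _]
    exact Finset.sum_congr rfl fun a _ => integral_indicator_one .of_discrete
  have hEX2 : ∫ ω, (X ^ 2) ω ∂μ = ∑ a ∈ T, ∑ b ∈ T, μ.real (E a ∩ E b) := by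
    have : X ^ 2 = fun ω => ∑ a ∈ T, ∑ b ∈ T, (E a ∩ E b).indicator 1 ω := by
      ext ω
      simp only [hX, Pi.pow_apply, sq, Finset.sum_mul_sum, Set.inter_indicator_one, Pi.mul_apply]
    rw [this, integral_finsetSum _ fun a _ => hint _]
    refine Finset.sum_congr rfl fun a _ => ?_
    rw [integral_finsetSum _ fun a _ => hint _]
    exact Finset.sum_congr rfl fun b _ => integral_indicator_one .of_discrete
  have hvar : ProbabilityTheory.variance X μ ≤ R := by
    rw [ProbabilityTheory.variance_eq_sub MemLp.of_discrete, hEX2, hEX, hm, sq,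
      Finset.sum_mul_sum, ← Finset.sum_sub_distrib]
    refine le_trans (Finset.sum_le_sum fun a ha => ?_) hR
    rw [← Finset.sum_sub_distrib, Finset.sum_filter]
    refine Finset.sum_le_sum fun b hb => ?_
    split_ifs with h
    · have : 0 ≤ μ.real (E a) * μ.real (E b) := by positivity
      linarith
    · rw [hD a ha b hb h, sub_self]
  have hcheb := ProbabilityTheory.meas_ge_le_variance_div_sq (μ := μ) (X := X) MemLp.of_discrete
    (half_pos hm0)
  have hv0 : 0 ≤ ProbabilityTheory.variance X μ := ProbabilityTheory.variance_nonneg X μ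
  have hcheb' := ENNReal.toReal_mono ENNReal.ofReal_ne_top hcheb
  rw [ENNReal.toReal_ofReal (by positivity), hEX] at hcheb'
  have hsub : {ω | 2 * ((T.filter fun a => ω ∈ E a).card : ℝ) ≤ m} ⊆ {ω | m / 2 ≤ |X ω - m|} := by
    intro ω hω
    have h2 : 2 * ((T.filter fun a => ω ∈ E a).card : ℝ) ≤ m := hω
    rw [← hXcard] at h2
    show m / 2 ≤ |X ω - m|
    rw [abs_sub_comm]
    exact le_trans (by linarith) (le_abs_self _)
  refine (measureReal_mono hsub).trans (hcheb'.trans ?_)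
  rw [div_pow, div_div_eq_mul_div, mul_comm]
  gcongr
  norm_num

theorem cliqueNum_mem_event_iff {V : Type*} [Fintype V] {d : ℕ} (f : V → Subcube d) (s : ℕ) :
    s ≤ (subcubeGraph f).cliqueNum ↔ ∃ A ∈ Finset.univ.powersetCard s, f ∈ cliqueEvent A := by
  rw [le_cliqueNum_iff]
  simp only [Finset.mem_powersetCard_univ, isClique_iff_compatible]
  rfl

theorem first_moment {V : Type*} [Fintype V] {d k : ℕ} (s : ℕ) {B : ℝ}
    (hB : ∀ A : Finset V, A.card = s → (uniformModel V d k).real (cliqueEvent A) ≤ B)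
    (hB0 : 0 ≤ B) :
    (uniformModel V d k).real {f | s ≤ (subcubeGraph f).cliqueNum}
      ≤ (Fintype.card V : ℝ) ^ s * B := by
  have h : {f : V → Subcube d | s ≤ (subcubeGraph f).cliqueNum}
      = ⋃ A ∈ Finset.univ.powersetCard s, cliqueEvent A := by
    ext f
    simp only [Set.mem_iUnion, exists_prop]
    exact cliqueNum_mem_event_iff f s
  rw [h]
  refine (measureReal_biUnion_finset_le _ _).trans ?_
  refine (Finset.sum_le_sum fun A hA => hB A (Finset.mem_powersetCard_univ.1 hA)).trans ?_
  rw [Finset.sum_const, Finset.card_powersetCard, nsmul_eq_mul, Finset.card_univ]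
  gcongr
  exact_mod_cast Nat.choose_le_pow _ _

open Classical in
/-- Extensions of a fixed part `J` to an `s`-set number at most `n^(s-|J|)`. -/
theorem card_inter_eq_le {V : Type*} [Fintype V] (A J : Finset V) (s : ℕ) :
    ((Finset.univ.powersetCard s).filter fun B : Finset V => A ∩ B = J).card
      ≤ Fintype.card V ^ (s - J.card) := by
  have h : ((Finset.univ.powersetCard s).filter fun B : Finset V => A ∩ B = J).card
      ≤ (Finset.univ.powersetCard (s - J.card) : Finset (Finset V)).card := by
    refine Finset.card_le_card_of_injOn (fun B => B \ J) ?_ ?_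
    · intro B hB
      simp only [Finset.coe_filter, Finset.mem_powersetCard_univ, Set.mem_ofPred_eq] at hB
      have hJB : J ⊆ B := by rw [← hB.2]; exact Finset.inter_subset_right
      simp only [Finset.mem_coe, Finset.mem_powersetCard_univ,
        Finset.card_sdiff_of_subset hJB, hB.1]
    · intro B hB B' hB' hBB
      simp only [Finset.coe_filter, Finset.mem_powersetCard_univ, Set.mem_ofPred_eq] at hB hB'
      have hJB : J ⊆ B := by rw [← hB.2]; exact Finset.inter_subset_right
      have hJB' : J ⊆ B' := by rw [← hB'.2]; exact Finset.inter_subset_right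
      have hBB' : B \ J = B' \ J := hBB
      rw [← Finset.sdiff_union_of_subset hJB, hBB', Finset.sdiff_union_of_subset hJB']
  refine h.trans ?_
  rw [Finset.card_powersetCard, Finset.card_univ]
  exact Nat.choose_le_pow _ _

theorem pow_le_mul_choose {n s : ℕ} (h : 2 * s ≤ n) :
    (n : ℝ) ^ s ≤ 2 ^ s * s.factorial * n.choose s := by
  have h1 := Nat.pow_le_choose (α := ℝ) s n
  rw [div_le_iff₀ (by positivity)] at h1
  have h2 : (n : ℝ) / 2 ≤ ((n + 1 - s : ℕ) : ℝ) := by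
    rw [Nat.cast_sub (by omega)]
    have : (2 * s : ℝ) ≤ n := by exact_mod_cast h
    push_cast
    linarith
  have h3 := (pow_le_pow_left₀ (by positivity) h2 s).trans h1
  rw [div_pow, div_le_iff₀ (by positivity)] at h3
  linarith

/-- Second moment method for the number of `s`-cliques; `lo` is a lower bound for the probability
of an `s`-clique, and `ζ` bounds the contribution of overlapping pairs. -/
theorem no_clique_real_le {V : Type*} [Fintype V] {d k s : ℕ} (hk : k ≤ d) (hs : 1 ≤ s)
    {lo ζ : ℝ} (hlo0 : 0 < lo)
    (hlo : ∀ A : Finset V, A.card = s → lo ≤ (uniformModel V d k).real (cliqueEvent A))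
    (hpair : ∀ A B : Finset V, A.card = s → B.card = s → ∀ J : Finset V, J.Nonempty →
      J.card ≤ s → (∀ v, v ∈ J ↔ v ∈ A ∧ v ∈ B) →
      (Fintype.card V : ℝ) ^ (s - J.card) * (uniformModel V d k).real (cliqueEvent A ∩ cliqueEvent B)
        ≤ (Fintype.card V : ℝ) ^ s * lo ^ 2 * ζ)
    (hζ : 0 ≤ ζ) (hn : 2 * s ≤ Fintype.card V) :
    (uniformModel V d k).real {f | ¬ s ≤ (subcubeGraph f).cliqueNum}
      ≤ 4 * (2 ^ s * (2 ^ s * s.factorial)) * ζ := by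
  classical
  have := isProbabilityMeasure_uniformModel V hk
  set μ := uniformModel V d k
  set n := Fintype.card V with hnd
  set T : Finset (Finset V) := Finset.univ.powersetCard s with hT
  have hTcard : T.card = n.choose s := by rw [hT, Finset.card_powersetCard, Finset.card_univ]
  have hTpos : (0 : ℝ) < n.choose s := by exact_mod_cast Nat.choose_pos (by omega)
  have hn0 : (0 : ℝ) < n := by exact_mod_cast (by omega : 0 < n)
  set m := ∑ A ∈ T, μ.real (cliqueEvent A) with hm
  have hmlo : n.choose s * lo ≤ m := by
    rw [← hTcard, ← nsmul_eq_mul, ← Finset.sum_const]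
    exact Finset.sum_le_sum fun A hA => hlo A (Finset.mem_powersetCard_univ.1 hA)
  have hm0 : 0 < m := lt_of_lt_of_le (by positivity) hmlo
  have hR : ∑ A ∈ T, ∑ B ∈ T with ¬ Disjoint A B, μ.real (cliqueEvent A ∩ cliqueEvent B)
      ≤ n.choose s * (2 ^ s * ((n : ℝ) ^ s * lo ^ 2 * ζ)) := by
    rw [← hTcard, ← nsmul_eq_mul, ← Finset.sum_const]
    refine Finset.sum_le_sum fun A hA => ?_
    have hAs := Finset.mem_powersetCard_univ.1 hA
    rw [← Finset.sum_fiberwise_of_maps_to (t := A.powerset) (g := fun B => A ∩ B)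
      fun B _ => Finset.mem_powerset.2 Finset.inter_subset_left]
    have hpow : (2 : ℝ) ^ s = (A.powerset.card : ℝ) := by
      rw [Finset.card_powerset, hAs]; push_cast; rfl
    rw [hpow, ← nsmul_eq_mul, ← Finset.sum_const]
    refine Finset.sum_le_sum fun J hJ => ?_
    have hRHS : 0 ≤ (n : ℝ) ^ s * lo ^ 2 * ζ := by positivity
    rcases J.eq_empty_or_nonempty with rfl | hJne
    · rw [Finset.sum_eq_zero]
      · exact hRHS
      · intro B hB
        simp only [Finset.mem_filter] at hB
        exact absurd (Finset.disjoint_iff_inter_eq_empty.2 hB.2) hB.1.2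
    · have hJs : J.card ≤ s := by rw [← hAs]; exact Finset.card_le_card (Finset.mem_powerset.1 hJ)
      have hnp : (0 : ℝ) < (n : ℝ) ^ (s - J.card) := by positivity
      have hterm : ∀ B ∈ (T.filter fun B => ¬ Disjoint A B).filter fun B => A ∩ B = J,
          μ.real (cliqueEvent A ∩ cliqueEvent B)
            ≤ (n : ℝ) ^ s * lo ^ 2 * ζ / (n : ℝ) ^ (s - J.card) := by
        intro B hB
        simp only [Finset.mem_filter] at hB
        rw [le_div_iff₀ hnp, mul_comm]
        refine hpair A B hAs (Finset.mem_powersetCard_univ.1 hB.1.1) J hJne hJs fun v => ?_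
        rw [← hB.2, Finset.mem_inter]
      refine (Finset.sum_le_sum hterm).trans ?_
      rw [Finset.sum_const, nsmul_eq_mul, mul_div_assoc', div_le_iff₀ hnp, mul_comm]
      refine mul_le_mul_of_nonneg_left ?_ hRHS
      have h1 : ((T.filter fun B => ¬ Disjoint A B).filter fun B => A ∩ B = J).card
          ≤ (T.filter fun B => A ∩ B = J).card :=
        Finset.card_le_card (Finset.filter_subset_filter _ (Finset.filter_subset _ _))
      exact_mod_cast h1.trans (card_inter_eq_le A J s)
  have hsm := second_moment (R := n.choose s * (2 ^ s * ((n : ℝ) ^ s * lo ^ 2 * ζ))) μ T (fun A => cliqueEvent A) (fun A B => ¬ Disjoint A B) (fun A _ B _ h => cliqueEvent_inter_of_disjoint hk (not_not.1 h))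
    (by convert hR) hm hm0
  refine le_trans (measureReal_mono fun f hf => ?_) (hsm.trans ?_)
  · have hf' : ¬ s ≤ (subcubeGraph f).cliqueNum := hf
    rw [cliqueNum_mem_event_iff] at hf'
    have h0 : (T.filter fun A => f ∈ cliqueEvent A) = ∅ :=
      Finset.filter_eq_empty_iff.2 fun A hA hfA => hf' ⟨A, hA, hfA⟩
    simp only [Set.mem_ofPred_eq, h0]
    simpa using hm0.le
  · have hch := pow_le_mul_choose hn
    rw [div_le_iff₀ (by positivity)]
    calc 4 * (n.choose s * (2 ^ s * ((n : ℝ) ^ s * lo ^ 2 * ζ)))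
        ≤ 4 * (n.choose s * (2 ^ s * ((2 ^ s * s.factorial * n.choose s) * lo ^ 2 * ζ))) := by
          gcongr
      _ = 4 * (2 ^ s * (2 ^ s * s.factorial)) * ζ * (n.choose s * lo) ^ 2 := by ring
      _ ≤ _ := by gcongr

/-! ### Below and above the threshold of a clique of bounded size -/

theorem whpCliqueNum_of_tendsto {α : ℝ} (hα0 : 0 < α) (hα1 : α < 1) (V : ℕ → Type*)
    [∀ d, Fintype (V d)] {A : ℕ → Set ℕ} {b : ℕ → ℝ}
    (h : ∀ᶠ d : ℕ in atTop, (uniformModel (V d) d ⌊α * (d : ℝ)⌋₊).real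
      {f | (subcubeGraph f).cliqueNum ∉ A d} ≤ b d) (hb : Tendsto b atTop (𝓝 0)) :
    WhpCliqueNum V (fun d => ⌊α * (d : ℝ)⌋₊) A := by
  unfold WhpCliqueNum
  have hprob := fun d => isProbabilityMeasure_uniformModel (V d) (floor_le hα0 hα1 d)
  rw [← ENNReal.tendsto_toReal_iff (fun d => measure_ne_top _ _) ENNReal.one_ne_top,
    ENNReal.toReal_one]
  have h2 : Tendsto (fun d => 1 - b d) atTop (𝓝 1) := by simpa using hb.const_sub 1
  refine tendsto_of_tendsto_of_tendsto_of_le_of_le' h2 tendsto_const_nhds ?_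
    (Eventually.of_forall fun d => measureReal_le_one)
  filter_upwards [h] with d hd
  have hc := probReal_compl_eq_one_sub (μ := uniformModel (V d) d ⌊α * (d : ℝ)⌋₊)
    (s := {f | (subcubeGraph f).cliqueNum ∈ A d}) .of_discrete
  have : {f : V d → Subcube d | (subcubeGraph f).cliqueNum ∉ A d}
      = {f | (subcubeGraph f).cliqueNum ∈ A d}ᶜ := rfl
  rw [this, hc] at hd
  have : (uniformModel (V d) d ⌊α * (d : ℝ)⌋₊).real {f | (subcubeGraph f).cliqueNum ∈ A d}
    = (uniformModel (V d) d ⌊α * (d : ℝ)⌋₊ {f | (subcubeGraph f).cliqueNum ∈ A d}).toReal := rfl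
  linarith

theorem card_eq_exp {V : Type*} [Fintype V] [Nonempty V] {d : ℕ} (hd : 0 < d) :
    (Fintype.card V : ℝ) = Real.exp (d * (Real.log (Fintype.card V : ℝ) / d)) := by
  have hd' : (0 : ℝ) < d := by exact_mod_cast hd
  have : (0 : ℝ) < Fintype.card V := by exact_mod_cast Fintype.card_pos
  rw [mul_div_cancel₀ _ hd'.ne', Real.exp_log this]

theorem tendsto_exp_neg_mul_atTop {c : ℝ} (hc : 0 < c) :
    Tendsto (fun d : ℕ => Real.exp (-((d : ℝ) * c))) atTop (𝓝 0) :=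
  Real.tendsto_exp_neg_atTop_nhds_zero.comp (tendsto_natCast_atTop_atTop.atTop_mul_const hc)

/-- Above `T_{K_s}` there is an `s`-clique with high probability. -/
theorem tendsto_no_clique {α : ℝ} (hα0 : 0 < α) (hα1 : α < 1) (V : ℕ → Type*)
    [∀ d, Fintype (V d)] [∀ d, Nonempty (V d)] {s : ℕ} (hs : 1 ≤ s) {ε : ℝ} (hε : 0 < ε)
    (h : ∀ᶠ d : ℕ in atTop, TClique s α + ε ≤ Real.log (Fintype.card (V d) : ℝ) / (d : ℝ)) :
    Tendsto (fun d : ℕ => (uniformModel (V d) d ⌊α * (d : ℝ)⌋₊).real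
      {f | ¬ s ≤ (subcubeGraph f).cliqueNum}) atTop (𝓝 0) := by
  classical
  have hs' : (0 : ℝ) < s := by exact_mod_cast hs
  -- The four factors `exp (s d η)` lost in the ratio of the pair bound to the square of the single
  -- bound must not use up the gain `exp (-d ε)` of the smallest overlap.
  obtain ⟨η, hη, hηε⟩ : ∃ η : ℝ, 0 < η ∧ 4 * s * η = ε / 2 :=
    ⟨ε / (8 * s), by positivity, by field_simp; norm_num⟩
  obtain ⟨⟨hp0, hp1⟩, -⟩ := alphaInv_mem hs hα0 hα1
  have hT0 := TClique_nonneg hα0 hα1 hs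
  have hlim : Tendsto (fun d : ℕ => 4 * (2 ^ s * (2 ^ s * (s.factorial : ℝ)))
      * Real.exp (-((d : ℝ) * (ε / 2)))) atTop (𝓝 0) := by
    simpa using (tendsto_exp_neg_mul_atTop (half_pos hε)).const_mul
      (4 * (2 ^ s * (2 ^ s * (s.factorial : ℝ))))
  have hbig : ∀ᶠ d : ℕ in atTop, (2 * s : ℝ) ≤ Real.exp (d * ε) :=
    (Real.tendsto_exp_atTop.comp
      (tendsto_natCast_atTop_atTop.atTop_mul_const hε)).eventually_ge_atTop _
  refine tendsto_of_tendsto_of_tendsto_of_le_of_le' tendsto_const_nhds hlim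
    (Eventually.of_forall fun d => measureReal_nonneg) ?_
  filter_upwards [h, eventually_clique_real_ge hα0 hα1 hs hη,
    eventually_pair_real_le hα0 hα1 hp0 hp1 hs hη, eventually_gt_atTop 0, hbig]
    with d hx hlo hpair hd hbig
  have hk := floor_le hα0 hα1 d
  have hd' : (0 : ℝ) < d := by exact_mod_cast hd
  have hcard := card_eq_exp (V := V d) hd
  set x := Real.log (Fintype.card (V d) : ℝ) / (d : ℝ)
  refine no_clique_real_le (lo := Real.exp (-(s * (d * (TClique s α + η))))) hk hs
    (Real.exp_pos _) ?_ ?_ (Real.exp_pos _).le ?_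
  · intro A hA
    rw [cliqueEvent_real hk]
    exact hlo A (by simpa using hA)
  · intro A B hA hB J hJ hJs hJAB
    have hJeq : J = A ∩ B := by ext v; rw [hJAB, Finset.mem_inter]
    have hcs : ∀ C : Finset (V d), C ⊆ A ∪ B →
        (C.subtype (· ∈ A ∪ B)).card = C.card := by
      intro C hC
      rw [Finset.card_subtype, Finset.filter_true_of_mem fun v hv => hC hv]
    have hpr := hpair (A ∪ B : Finset (V d)) (A.subtype (· ∈ A ∪ B)) (B.subtype (· ∈ A ∪ B)) J.card
      (by ext ⟨v, hv⟩; simpa using hv) (by rw [hcs A Finset.subset_union_left, hA])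
      (by rw [hcs B Finset.subset_union_right, hB])
      (by
        rw [hJeq, ← hcs (A ∩ B) (Finset.inter_subset_left.trans Finset.subset_union_left)]
        congr 1; ext v; simp)
    rw [← cliqueEvent_inter_real hk, ← TClique_eq] at hpr
    have hnj : Real.exp (J.card * (d * (TClique s α + ε))) ≤ (Fintype.card (V d) : ℝ) ^ J.card := by
      rw [hcard, ← Real.exp_nat_mul, Real.exp_le_exp]
      exact mul_le_mul_of_nonneg_left (mul_le_mul_of_nonneg_left hx hd'.le) (Nat.cast_nonneg _)
    have hsplit : (Fintype.card (V d) : ℝ) ^ s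
        = (Fintype.card (V d) : ℝ) ^ (s - J.card) * (Fintype.card (V d) : ℝ) ^ J.card := by
      rw [← pow_add, Nat.sub_add_cancel hJs]
    rw [hsplit, mul_assoc, mul_assoc]
    refine mul_le_mul_of_nonneg_left (hpr.trans ?_) (by positivity)
    refine le_trans ?_ (mul_le_mul_of_nonneg_right hnj (by positivity))
    rw [← Real.exp_nat_mul, ← Real.exp_add, ← Real.exp_add, Real.exp_le_exp,
      Nat.cast_sub (by omega)]
    have hj1 : (1 : ℝ) ≤ J.card := by exact_mod_cast hJ.card_pos
    have h1 : 0 ≤ (J.card - 1 : ℝ) * (d * ε) := mul_nonneg (by linarith) (by positivity)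
    have h2 : 0 ≤ (J.card : ℝ) * (d * η) := mul_nonneg (Nat.cast_nonneg _) (by positivity)
    have h3 : d * (4 * s * η) = d * (ε / 2) := by rw [hηε]
    push_cast
    linarith
  · have h1 : Real.exp (d * ε) ≤ Fintype.card (V d) := by
      rw [hcard, Real.exp_le_exp]
      exact mul_le_mul_of_nonneg_left (by linarith) hd'.le
    exact_mod_cast hbig.trans h1

/-- Below `T_{K_s}` there is no `s`-clique with high probability. -/
theorem tendsto_clique {α : ℝ} (hα0 : 0 < α) (hα1 : α < 1) (V : ℕ → Type*)
    [∀ d, Fintype (V d)] [∀ d, Nonempty (V d)] {s : ℕ} (hs : 1 ≤ s) {ε : ℝ} (hε : 0 < ε)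
    (h : ∀ᶠ d : ℕ in atTop, Real.log (Fintype.card (V d) : ℝ) / (d : ℝ) ≤ TClique s α - ε) :
    Tendsto (fun d : ℕ => (uniformModel (V d) d ⌊α * (d : ℝ)⌋₊).real
      {f | s ≤ (subcubeGraph f).cliqueNum}) atTop (𝓝 0) := by
  obtain ⟨⟨hp0, hp1⟩, -⟩ := alphaInv_mem hs hα0 hα1
  have hs' : (0 : ℝ) < s := by exact_mod_cast hs
  refine tendsto_of_tendsto_of_tendsto_of_le_of_le' tendsto_const_nhds
    (tendsto_exp_neg_mul_atTop (show 0 < s * (ε / 2) by positivity))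
    (Eventually.of_forall fun d => measureReal_nonneg) ?_
  filter_upwards [h, eventually_clique_real_le hα0 hα1 hp0 hp1 hs (half_pos hε),
    eventually_gt_atTop 0] with d hx hup hd
  have hk := floor_le hα0 hα1 d
  have hd' : (0 : ℝ) < d := by exact_mod_cast hd
  refine (first_moment s (B := Real.exp (-(s * (d * (TClique s α - ε / 2))))) ?_
    (Real.exp_pos _).le).trans ?_
  · intro A hA
    rw [cliqueEvent_real hk, TClique_eq]
    exact hup A (by simpa using hA)
  · rw [card_eq_exp (V := V d) hd, ← Real.exp_nat_mul, ← Real.exp_add, Real.exp_le_exp]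
    have h1 := mul_le_mul_of_nonneg_left hx (by positivity : (0 : ℝ) ≤ s * d)
    linarith

theorem whp_eq_of_between {α : ℝ} (hα0 : 0 < α) (hα1 : α < 1) (V : ℕ → Type*)
    [∀ d, Fintype (V d)] [∀ d, Nonempty (V d)] {s : ℕ} (hs : 1 ≤ s) {ε : ℝ} (hε : 0 < ε)
    (h : ∀ᶠ d : ℕ in atTop, TClique s α + ε < Real.log (Fintype.card (V d) : ℝ) / (d : ℝ) ∧
      Real.log (Fintype.card (V d) : ℝ) / (d : ℝ) < TClique (s + 1) α - ε) :
    WhpCliqueNum V (fun d => ⌊α * (d : ℝ)⌋₊) fun _ => {s} := by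
  have h1 := tendsto_no_clique hα0 hα1 V hs hε (h.mono fun d hd => hd.1.le)
  have h2 := tendsto_clique hα0 hα1 V (by omega : 1 ≤ s + 1) hε (h.mono fun d hd => hd.2.le)
  refine whpCliqueNum_of_tendsto hα0 hα1 V (Eventually.of_forall fun d => ?_) (by simpa using h1.add h2)
  have := isProbabilityMeasure_uniformModel (V d) (floor_le hα0 hα1 d)
  refine le_trans (measureReal_mono fun f hf => ?_) (measureReal_union_le _ _)
  simp only [Set.mem_ofPred_eq, Set.mem_singleton_iff, Set.mem_union] at hf ⊢
  omega

theorem whp_mem_pair_of_tendsto {α : ℝ} (hα0 : 0 < α) (hα1 : α < 1) (V : ℕ → Type*)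
    [∀ d, Fintype (V d)] [∀ d, Nonempty (V d)] {s : ℕ} (hs : 1 ≤ s)
    (h : Tendsto (fun d : ℕ => Real.log (Fintype.card (V d) : ℝ) / (d : ℝ)) atTop
      (𝓝 (TClique s α))) :
    WhpCliqueNum V (fun d => ⌊α * (d : ℝ)⌋₊) fun _ => {s - 1, s} := by
  have h2 : Tendsto (fun d : ℕ => (uniformModel (V d) d ⌊α * (d : ℝ)⌋₊).real
      {f | s + 1 ≤ (subcubeGraph f).cliqueNum}) atTop (𝓝 0) := by
    have hlt := TClique_lt_succ hα0 hα1 hs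
    refine tendsto_clique hα0 hα1 V (by omega : 1 ≤ s + 1) (half_pos (sub_pos.2 hlt)) ?_
    exact (h.eventually_lt_const (by linarith)).mono fun d hd => hd.le
  have h1 : Tendsto (fun d : ℕ => (uniformModel (V d) d ⌊α * (d : ℝ)⌋₊).real
      {f | ¬ s - 1 ≤ (subcubeGraph f).cliqueNum}) atTop (𝓝 0) := by
    rcases Nat.eq_or_lt_of_le hs with rfl | hs2
    · simp
    · obtain ⟨t, rfl⟩ : ∃ t, s = t + 1 := ⟨s - 1, by omega⟩
      have hlt := TClique_lt_succ hα0 hα1 (s := t) (by omega)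
      refine tendsto_no_clique hα0 hα1 V (by omega) (half_pos (sub_pos.2 hlt)) ?_
      exact (h.eventually_const_lt (by simp only [Nat.add_sub_cancel]; linarith)).mono
        fun d hd => hd.le
  refine whpCliqueNum_of_tendsto hα0 hα1 V (Eventually.of_forall fun d => ?_) (by simpa using h1.add h2)
  have := isProbabilityMeasure_uniformModel (V d) (floor_le hα0 hα1 d)
  refine le_trans (measureReal_mono fun f hf => ?_) (measureReal_union_le _ _)
  simp only [Set.mem_ofPred_eq, Set.mem_singleton_iff, Set.mem_union, Set.mem_insert_iff] at hf ⊢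
  omega

/-! ### Above the covering threshold -/

theorem uniformOn_real_mem {d k : ℕ} (hk : k ≤ d) (y : Hypercube d) :
    (ProbabilityTheory.uniformOn {c : Subcube d | c.dim = k}).real {c | y ∈ c.points}
      = (2 ^ (d - k))⁻¹ := by
  classical
  rw [uniformOn_real_dim]
  have h := Subcube.card_dim_eq_mem d k y
  have hc : (0 : ℝ) < d.choose k := by exact_mod_cast Nat.choose_pos hk
  have : ((Finset.univ.filter fun c : Subcube d => c.dim = k ∧ c ∈ {c : Subcube d | y ∈ c.points}).card : ℝ)
      = d.choose k := by
    rw [← h]; congr!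
  rw [this, numSubcubes]
  push_cast
  field_simp

theorem uniformModel_real_all_mem {V : Type*} [Fintype V] {d k : ℕ} (hk : k ≤ d) (y : Hypercube d)
    (A : Finset V) : (uniformModel V d k).real {f | ∀ v ∈ A, y ∈ (f v).points}
      = ((2 ^ (d - k))⁻¹ : ℝ) ^ A.card := by
  classical
  have := isProbabilityMeasure_uniformOn_dim hk
  have h : {f : V → Subcube d | ∀ v ∈ A, y ∈ (f v).points}
      = Set.univ.pi fun v => if v ∈ A then {c | y ∈ c.points} else Set.univ := by
    ext f
    simp only [Set.mem_ofPred_eq, Set.mem_univ_pi]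
    refine forall_congr' fun v => ?_
    by_cases hv : v ∈ A <;> simp [hv]
  rw [h, Measure.real, uniformModel, Measure.pi_pi, ENNReal.toReal_prod]
  have h2 : ∀ v, (ProbabilityTheory.uniformOn {c : Subcube d | c.dim = k}
      (if v ∈ A then {c | y ∈ c.points} else Set.univ)).toReal
      = if v ∈ A then ((2 ^ (d - k))⁻¹ : ℝ) else 1 := by
    intro v
    by_cases hv : v ∈ A
    · simp only [hv, if_true]; exact uniformOn_real_mem hk y
    · simp [hv]
  rw [Finset.prod_congr rfl fun v _ => h2 v, Finset.prod_ite_mem, Finset.univ_inter,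
    Finset.prod_const]

/-- The expected number of subcubes that cover a given point. -/
noncomputable def coverMean (n d k : ℕ) : ℝ := n * (2 ^ (d - k))⁻¹

/-- Chebyshev's inequality for the number of subcubes that cover the origin. -/
theorem coverMean_le_cliqueNum {V : Type*} [Fintype V] [Nonempty V] {d k : ℕ} (hk : k ≤ d) :
    (uniformModel V d k).real
        {f | 2 * ((subcubeGraph f).cliqueNum : ℝ) ≤ coverMean (Fintype.card V) d k}
      ≤ 4 / coverMean (Fintype.card V) d k := by
  classical
  have := isProbabilityMeasure_uniformModel V hk
  set μ := uniformModel V d k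
  set m := coverMean (Fintype.card V) d k with hm
  have hm0 : 0 < m := by
    have : (0 : ℝ) < Fintype.card V := by exact_mod_cast Fintype.card_pos
    rw [hm, coverMean]; positivity
  let y : Hypercube d := fun _ => false
  have hE : ∀ v, μ.real {f : V → Subcube d | y ∈ (f v).points} = (2 ^ (d - k))⁻¹ := by
    intro v
    simpa using uniformModel_real_all_mem hk y {v}
  have hsum : m = ∑ v : V, μ.real {f : V → Subcube d | y ∈ (f v).points} := by
    simp [hE, hm, coverMean]
  have hsm := second_moment (R := m) μ Finset.univ
    (fun v : V => {f : V → Subcube d | y ∈ (f v).points}) (fun a b => a = b) ?_ ?_ hsum hm0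
  · refine le_trans (measureReal_mono fun f hf => ?_) (hsm.trans (le_of_eq (by field_simp)))
    have hf' : 2 * ((subcubeGraph f).cliqueNum : ℝ) ≤ m := hf
    have hcl := SimpleGraph.IsClique.card_le_cliqueNum (G := subcubeGraph f)
      (t := Finset.univ.filter fun v => y ∈ (f v).points)
      (tc := isClique_of_common_point f (y := y) (by simp))
    have hcl' : ((Finset.univ.filter fun v => y ∈ (f v).points).card : ℝ)
      ≤ (subcubeGraph f).cliqueNum := by exact_mod_cast hcl
    show 2 * ((Finset.univ.filter fun v => y ∈ (f v).points).card : ℝ) ≤ m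
    linarith
  · intro a _ b _ hab
    have h := uniformModel_real_all_mem hk y {a, b}
    rw [Finset.card_pair hab] at h
    rw [hE, hE, ← sq, ← h]
    congr 1
    ext f
    simp
  · rw [hsum]
    refine Finset.sum_le_sum fun a _ => ?_
    have : (Finset.univ.filter fun b => a = b) = {a} := by ext; simp [eq_comm]
    rw [this, Finset.sum_singleton, Set.inter_self]

theorem mul_pow_le_factorial (M : ℕ) : (M : ℝ) ^ M ≤ 3 ^ M * M.factorial := by
  have h := Real.pow_div_factorial_le_exp (M : ℝ) (by positivity) M
  rw [div_le_iff₀ (by positivity)] at h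
  refine h.trans ?_
  have h2 : Real.exp M ≤ 3 ^ M := by
    rw [← mul_one (M : ℝ), Real.exp_nat_mul]
    exact pow_le_pow_left₀ (Real.exp_pos _).le Real.exp_one_lt_three.le _
  gcongr

/-- Union bound over the common points and the sets of `⌈6m⌉` vertices. -/
theorem cliqueNum_le_coverMean {V : Type*} [Fintype V] {d k : ℕ} (hk : k ≤ d)
    (hm : (d : ℝ) ≤ coverMean (Fintype.card V) d k) :
    (uniformModel V d k).real
        {f | 6 * coverMean (Fintype.card V) d k ≤ (subcubeGraph f).cliqueNum}
      ≤ (1 / 2) ^ d := by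
  classical
  have := isProbabilityMeasure_uniformModel V hk
  set μ := uniformModel V d k
  set m := coverMean (Fintype.card V) d k with hmd
  set M := ⌈6 * m⌉₊ with hM
  have hm0 : 0 ≤ m := le_trans (by positivity) hm
  have hMm : 6 * m ≤ M := Nat.le_ceil _
  have hMd : 2 * d ≤ M := by
    have : (2 * d : ℝ) ≤ M := by linarith
    exact_mod_cast this
  have hsub : {f : V → Subcube d | 6 * m ≤ (subcubeGraph f).cliqueNum}
      ⊆ ⋃ z ∈ (Finset.univ : Finset (Hypercube d)) ×ˢ (Finset.univ : Finset V).powersetCard M,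
        {f : V → Subcube d | ∀ v ∈ z.2, z.1 ∈ (f v).points} := by
    intro f hf
    have hf' : M ≤ (subcubeGraph f).cliqueNum := Nat.ceil_le.2 hf
    obtain ⟨A, hA, hAc⟩ := (le_cliqueNum_iff _ _).1 hf'
    obtain ⟨y, hy⟩ := exists_common_point f hAc
    simp only [Set.mem_iUnion]
    exact ⟨(y, A), by simp [hA], hy⟩
  refine (measureReal_mono hsub (measure_ne_top _ _)).trans ((measureReal_biUnion_finset_le _ _).trans ?_)
  have hterm : ∀ z ∈ (Finset.univ : Finset (Hypercube d)) ×ˢ (Finset.univ : Finset V).powersetCard M,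
      μ.real {f : V → Subcube d | ∀ v ∈ z.2, z.1 ∈ (f v).points}
        = ((2 ^ (d - k))⁻¹ : ℝ) ^ M := by
    intro z hz
    rw [Finset.mem_product, Finset.mem_powersetCard_univ] at hz
    rw [uniformModel_real_all_mem hk, hz.2]
  rw [Finset.sum_congr rfl hterm, Finset.sum_const, Finset.card_product, Finset.card_powersetCard,
    nsmul_eq_mul]
  simp only [Finset.card_univ, Fintype.card_pi, Fintype.card_bool, Finset.prod_const,
    Fintype.card_fin]
  push_cast
  have hch := Nat.choose_le_pow_div (α := ℝ) M (Fintype.card V)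
  have h2 : ((Fintype.card V).choose M : ℝ) * ((2 ^ (d - k))⁻¹) ^ M ≤ (1 / 2) ^ M := by
    calc _ ≤ (Fintype.card V : ℝ) ^ M / M.factorial * ((2 ^ (d - k))⁻¹) ^ M := by gcongr
      _ = m ^ M / M.factorial := by rw [hmd, coverMean, mul_pow]; ring
      _ ≤ (M / 6 : ℝ) ^ M / M.factorial := by gcongr; linarith
      _ ≤ (1 / 2) ^ M := by
        rw [div_le_iff₀ (by positivity), div_pow, div_le_iff₀ (by positivity)]
        refine (mul_pow_le_factorial M).trans (le_of_eq ?_)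
        rw [mul_right_comm, ← mul_pow]; norm_num
  calc (2 : ℝ) ^ d * (Fintype.card V).choose M * ((2 ^ (d - k))⁻¹) ^ M
      ≤ 2 ^ d * (1 / 2) ^ M := by rw [mul_assoc]; gcongr
    _ ≤ 2 ^ d * (1 / 2) ^ (2 * d) := by
      gcongr 2 ^ d * ?_
      exact pow_le_pow_of_le_one (by norm_num) (by norm_num) hMd
    _ = (1 / 2) ^ d := by
      rw [two_mul, pow_add, ← mul_assoc, ← mul_pow]; norm_num

/-- If `log m / ℓ → γ`, where `m` is the expected number of subcubes covering a point, then the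
clique number is `exp ((γ + o(1)) ℓ)`. -/
theorem whp_exp_of_coverMean {α : ℝ} (hα0 : 0 < α) (hα1 : α < 1) (V : ℕ → Type*)
    [∀ d, Fintype (V d)] [∀ d, Nonempty (V d)] {ℓ : ℕ → ℝ} (hℓ : Tendsto ℓ atTop atTop) {γ : ℝ}
    (hm : Tendsto (fun d : ℕ => Real.log (coverMean (Fintype.card (V d)) d ⌊α * (d : ℝ)⌋₊) / ℓ d)
      atTop (𝓝 γ))
    (hmd : Tendsto (fun d : ℕ => Real.log (coverMean (Fintype.card (V d)) d ⌊α * (d : ℝ)⌋₊)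
      - Real.log d) atTop atTop) :
    ∃ r : ℕ → ℝ, Tendsto r atTop (𝓝 0) ∧ WhpCliqueNum V (fun d => ⌊α * (d : ℝ)⌋₊)
      fun d => {w : ℕ | Real.exp ((γ - r d) * ℓ d) ≤ w ∧ (w : ℝ) ≤ Real.exp ((γ + r d) * ℓ d)} := by
  set m : ℕ → ℝ := fun d => coverMean (Fintype.card (V d)) d ⌊α * (d : ℝ)⌋₊ with hmdef
  have hm0 : ∀ d, 0 < m d := by
    intro d
    have : (0 : ℝ) < Fintype.card (V d) := by exact_mod_cast Fintype.card_pos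
    simp only [hmdef, coverMean]; positivity
  refine ⟨fun d => |Real.log (m d) / ℓ d - γ| + Real.log 6 / ℓ d, ?_, ?_⟩
  · have h1 : Tendsto (fun d => |Real.log (m d) / ℓ d - γ|) atTop (𝓝 0) := by
      simpa using (hm.sub_const γ).abs
    simpa using h1.add (hℓ.const_div_atTop (Real.log 6))
  have hdm : ∀ᶠ d : ℕ in atTop, (d : ℝ) ≤ m d := by
    filter_upwards [hmd.eventually_ge_atTop 0, eventually_gt_atTop 0] with d hd hd0
    have hd' : (0 : ℝ) < d := by exact_mod_cast hd0
    rw [← Real.log_le_log_iff hd' (hm0 d)]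
    simp only [hmdef] at hd ⊢
    linarith
  have hmtop : Tendsto m atTop atTop := tendsto_atTop_mono' _ hdm tendsto_natCast_atTop_atTop
  have hb : Tendsto (fun d => 4 / m d + (1 / 2 : ℝ) ^ d) atTop (𝓝 0) := by
    simpa using (hmtop.const_div_atTop 4).add
      (tendsto_pow_atTop_nhds_zero_of_lt_one (by norm_num) (by norm_num : (1 / 2 : ℝ) < 1))
  refine whpCliqueNum_of_tendsto hα0 hα1 V ?_ hb
  filter_upwards [hdm, hℓ.eventually_gt_atTop 0] with d hd hl
  have hk := floor_le hα0 hα1 d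
  have := isProbabilityMeasure_uniformModel (V d) hk
  refine le_trans (measureReal_mono fun f hf => ?_) ((measureReal_union_le _ _).trans
    (add_le_add (coverMean_le_cliqueNum hk) (cliqueNum_le_coverMean hk hd)))
  by_contra hcon
  apply hf
  simp only [Set.mem_ofPred_eq, Set.mem_union, not_or, not_le] at hcon
  obtain ⟨h1, h2⟩ := hcon
  have h1' : m d < 2 * ((subcubeGraph f).cliqueNum : ℝ) := h1
  have h2' : ((subcubeGraph f).cliqueNum : ℝ) < 6 * m d := h2
  have hr : (|Real.log (m d) / ℓ d - γ| + Real.log 6 / ℓ d) * ℓ d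
      = |Real.log (m d) - γ * ℓ d| + Real.log 6 := by
    rw [add_mul, div_mul_cancel₀ _ hl.ne']
    congr 1
    rw [← abs_of_pos hl, ← abs_mul, abs_of_pos hl, sub_mul, div_mul_cancel₀ _ hl.ne']
  have h6 : Real.exp (Real.log 6) = 6 := Real.exp_log (by norm_num)
  constructor
  · refine le_trans ?_ (show m d / 6 ≤ _ by linarith [hm0 d])
    rw [sub_mul, hr, ← Real.exp_log (hm0 d), ← h6, ← Real.exp_sub, Real.exp_le_exp, h6,
      Real.exp_log (hm0 d)]
    linarith [neg_abs_le (Real.log (m d) - γ * ℓ d)]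
  · refine h2'.le.trans ?_
    rw [add_mul, hr, ← Real.exp_log (hm0 d), ← h6, ← Real.exp_add, Real.exp_le_exp, h6,
      Real.exp_log (hm0 d)]
    linarith [le_abs_self (Real.log (m d) - γ * ℓ d)]

/-- The error `log 2` comes from rounding `α d` to an integer. -/
theorem abs_log_coverMean_sub_le {α : ℝ} (hα0 : 0 < α) (hα1 : α < 1) (V : Type*)
    [Fintype V] [Nonempty V] {d : ℕ} (hd : 0 < d) :
    |Real.log (coverMean (Fintype.card V) d ⌊α * (d : ℝ)⌋₊)
      - d * (Real.log (Fintype.card V : ℝ) / d - TCover α)| ≤ Real.log 2 := by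
  have hk := floor_le hα0 hα1 d
  have hd' : (0 : ℝ) < d := by exact_mod_cast hd
  have hV : (0 : ℝ) < Fintype.card V := by exact_mod_cast Fintype.card_pos
  have h1 := Nat.floor_le (a := α * (d : ℝ)) (by positivity)
  have h2 := Nat.lt_floor_add_one (α * (d : ℝ))
  have hl2 : 0 < Real.log 2 := Real.log_pos (by norm_num)
  unfold coverMean TCover
  rw [Real.log_mul hV.ne' (by positivity), Real.log_inv, Real.log_pow, Nat.cast_sub hk, mul_sub,
    mul_div_cancel₀ _ hd'.ne']
  have e : Real.log (Fintype.card V : ℝ) + -((d - (⌊α * (d : ℝ)⌋₊ : ℝ)) * Real.log 2)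
      - (Real.log (Fintype.card V : ℝ) - d * ((1 - α) * Real.log 2))
      = ((⌊α * (d : ℝ)⌋₊ : ℝ) - α * d) * Real.log 2 := by ring
  rw [e, abs_mul, abs_of_pos hl2]
  have : |(⌊α * (d : ℝ)⌋₊ : ℝ) - α * d| ≤ 1 := by rw [abs_le]; constructor <;> linarith
  nlinarith

theorem tendsto_log_coverMean_div {α : ℝ} (hα0 : 0 < α) (hα1 : α < 1) (V : ℕ → Type*)
    [∀ d, Fintype (V d)] [∀ d, Nonempty (V d)] {ℓ : ℕ → ℝ} (hℓ : Tendsto ℓ atTop atTop) {γ : ℝ}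
    (h : Tendsto (fun d : ℕ => d * (Real.log (Fintype.card (V d) : ℝ) / d - TCover α) / ℓ d)
      atTop (𝓝 γ)) :
    Tendsto (fun d : ℕ => Real.log (coverMean (Fintype.card (V d)) d ⌊α * (d : ℝ)⌋₊) / ℓ d)
      atTop (𝓝 γ) := by
  rw [← tendsto_sub_nhds_zero_iff] at h ⊢
  have h2 : Tendsto (fun d : ℕ => (Real.log (coverMean (Fintype.card (V d)) d ⌊α * (d : ℝ)⌋₊)
      - d * (Real.log (Fintype.card (V d) : ℝ) / d - TCover α)) / ℓ d) atTop (𝓝 0) := by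
    refine squeeze_zero_norm' ?_ (hℓ.const_div_atTop (Real.log 2))
    filter_upwards [eventually_gt_atTop 0, hℓ.eventually_gt_atTop 0] with d hd hl
    rw [Real.norm_eq_abs, abs_div, abs_of_pos hl]
    gcongr
    exact abs_log_coverMean_sub_le hα0 hα1 (V d) hd
  have h3 := h.add h2
  rw [add_zero] at h3
  refine h3.congr fun d => ?_
  ring

/-! ### The transition of the clique number -/

theorem mainTheorem10 (α : ℝ) (hα0 : 0 < α) (hα1 : α < 1)
    (V : ℕ → Type*) [∀ d, Fintype (V d)] [∀ d, Nonempty (V d)]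
    (x : ℕ → ℝ) (hx : ∀ d : ℕ, x d = Real.log (Fintype.card (V d) : ℝ) / (d : ℝ))
    (k : ℕ → ℕ) (hk : ∀ d : ℕ, k d = ⌊α * (d : ℝ)⌋₊) :
    (∀ s : ℕ, 1 ≤ s → ∀ ε : ℝ, 0 < ε →
      (∀ᶠ d : ℕ in atTop, TClique s α + ε < x d ∧ x d < TClique (s + 1) α - ε) →
      WhpCliqueNum V k (fun _ => {s})) ∧
    (∀ s : ℕ, 1 ≤ s →
      Tendsto x atTop (𝓝 (TClique s α)) →
      WhpCliqueNum V k (fun _ => {s - 1, s})) ∧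
    (∀ γ : ℝ, 1 < γ →
      (fun d : ℕ => x d - (TCover α + γ * (Real.log (d : ℝ) / (d : ℝ))))
        =o[atTop] (fun d : ℕ => Real.log (d : ℝ) / (d : ℝ)) →
      ∃ r : ℕ → ℝ, Tendsto r atTop (𝓝 0) ∧
        WhpCliqueNum V k (fun d => {w : ℕ |
          (d : ℝ) ^ (γ - r d) ≤ (w : ℝ) ∧ (w : ℝ) ≤ (d : ℝ) ^ (γ + r d)})) ∧
    (∀ c : ℝ, 0 < c →
      Tendsto x atTop (𝓝 (TCover α + c)) →
      ∃ r : ℕ → ℝ, Tendsto r atTop (𝓝 0) ∧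
        WhpCliqueNum V k (fun d => {w : ℕ |
          Real.exp ((c - r d) * (d : ℝ)) ≤ (w : ℝ) ∧
            (w : ℝ) ≤ Real.exp ((c + r d) * (d : ℝ))})) := by
  obtain rfl : k = fun d : ℕ => ⌊α * (d : ℝ)⌋₊ := funext hk
  obtain rfl : x = fun d => Real.log (Fintype.card (V d) : ℝ) / (d : ℝ) := funext hx
  refine ⟨fun s hs ε hε h => whp_eq_of_between hα0 hα1 V hs hε h,
    fun s hs h => whp_mem_pair_of_tendsto hα0 hα1 V hs h, fun γ hγ h => ?_, fun c hc h => ?_⟩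
  · have hlog : Tendsto (fun d : ℕ => Real.log (d : ℝ)) atTop atTop :=
      Real.tendsto_log_atTop.comp tendsto_natCast_atTop_atTop
    have h1 : Tendsto (fun d : ℕ => d * (Real.log (Fintype.card (V d) : ℝ) / d - TCover α)
        / Real.log d) atTop (𝓝 γ) := by
      have h2 := h.tendsto_div_nhds_zero.add_const γ
      rw [zero_add] at h2
      refine h2.congr' ?_
      filter_upwards [eventually_gt_atTop 0, hlog.eventually_gt_atTop 0] with d hd hl
      have hd' : (0 : ℝ) < d := by exact_mod_cast hd
      field_simp
      ring
    have h3 := tendsto_log_coverMean_div hα0 hα1 V hlog h1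
    have h4 : Tendsto (fun d : ℕ => Real.log (coverMean (Fintype.card (V d)) d ⌊α * (d : ℝ)⌋₊)
        - Real.log d) atTop atTop := by
      have h5 := Tendsto.pos_mul_atTop (by linarith : 0 < γ - 1) (h3.sub_const 1) hlog
      refine h5.congr' ?_
      filter_upwards [hlog.eventually_gt_atTop 0] with d hl
      field_simp
    obtain ⟨r, hr, hw⟩ := whp_exp_of_coverMean hα0 hα1 V hlog h3 h4
    refine ⟨r, hr, hw.congr' ?_⟩
    filter_upwards [eventually_gt_atTop 0] with d hd
    have hd' : (0 : ℝ) < d := by exact_mod_cast hd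
    simp only [Real.rpow_def_of_pos hd', mul_comm (Real.log (d : ℝ))]
  · have hid : Tendsto (fun d : ℕ => (d : ℝ)) atTop atTop := tendsto_natCast_atTop_atTop
    have h1 : Tendsto (fun d : ℕ => d * (Real.log (Fintype.card (V d) : ℝ) / d - TCover α)
        / (d : ℝ)) atTop (𝓝 c) := by
      have h2 := h.sub_const (TCover α)
      rw [add_sub_cancel_left] at h2
      refine h2.congr' ?_
      filter_upwards [eventually_gt_atTop 0] with d hd
      have hd' : (0 : ℝ) < d := by exact_mod_cast hd
      field_simp
    have h3 := tendsto_log_coverMean_div hα0 hα1 V hid h1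
    have h4 : Tendsto (fun d : ℕ => Real.log (coverMean (Fintype.card (V d)) d ⌊α * (d : ℝ)⌋₊)
        - Real.log d) atTop atTop := by
      have hlogd : Tendsto (fun d : ℕ => Real.log (d : ℝ) / d) atTop (𝓝 0) :=
        Real.isLittleO_log_id_atTop.tendsto_div_nhds_zero.comp hid
      have h5 := Tendsto.pos_mul_atTop (by linarith : 0 < c - 0) (h3.sub hlogd) hid
      refine h5.congr' ?_
      filter_upwards [eventually_gt_atTop 0] with d hd
      have hd' : (0 : ℝ) < d := by exact_mod_cast hd
      field_simp
    exact whp_exp_of_coverMean hα0 hα1 V hid h3 h4
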